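/- **Theorem 5.3 (a cycle of minimal radius can be computed in polynomial time).** Let $K$ be a finite simplicial complex on the vertices $0,\dots,m-1$, and consider simplicial homology with coefficients in $\mathbb{Z}_2$. For vertices $p,q$ let $\mathrm{dist}(p,q)$ be the number of edges of a shortest path from $p$ to $q$ in the $1$-skeleton of $K$ ($\infty$ if there is none). The *radius* of a $d$-cycle $z$ is $$\mathrm{rad}(z)=\min_{p\in \mathrm{vert}(K)}\ \max_{q\in \mathrm{vert}(z)}\mathrm{dist}(p,q)\in\mathbb{N}\cup\{\infty\},$$ where $\mathrm{vert}(z)$ is the set of vertices of the simplices that occur in $z$ (the maximum over the empty set is $0$, the minimum over the empty set is $\infty$). Equivalently, when finite, it is the radius of a smallest geodesic ball $B_p^r=\{\sigma\in K : \mathrm{dist}(p,q)\le r \text{ for all vertices } q \text{ of } \sigma\}$ that contains all simplices of $z$. There are a single algorithm and a polynomial $P$ with the following property. Given any such $K$, as a list of its simplices in any order, any $d\ge 0$, and a cycle $z_0\in Z_d(K)$, as a $0/1$-vector on this list, the algorithm halts after at most $P(n)$ steps, where $n$ is the number of simplices of $K$, and outputs, as a $0/1$-vector on the same list, a cycle $z_r$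 of minimal radius in the homology class $h=[z_0]\in H_d(K)$: $$z_r\in h\qquad\text{and}\qquad \mathrm{rad}(z_r)\le \mathrm{rad}(z)\quad\text{for all cycles } z\in h.$$ Here an algorithm is a program for a random access machine with finitely many registers and arrays of natural numbers, built from assignments, sequencing, conditionals and while loops, with constants, array access, addition and truncated subtraction at unit cost. -/

import Mathlib

namespace MinRadius

/-! ### Random access machine with a step count

A program uses registers and arrays indexed by natural numbers; a given program mentions only
finitely many of them.  Every operation (constant, register access, array access, addition,
truncated subtraction, assignment, test) costs one step.  There is no multiplication, so in `t` steps
numbers grow by at most `t` bits, and polynomial time has its usual (Turing machine) meaning. -/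

/-- A memory state: the register contents and the contents of the arrays. -/
structure State where
  reg : ℕ → ℕ
  arr : ℕ → ℕ → ℕ

/-- Expressions.  `read a e` is the cell of array `a` at index `e`. -/
inductive Expr where
  | const (c : ℕ)
  | reg (r : ℕ)
  | read (a : ℕ) (e : Expr)
  | add (e₁ e₂ : Expr)
  | sub (e₁ e₂ : Expr)

/-- The value of an expression in a state. -/
def Expr.eval (s : State) : Expr → ℕ
  | .const c => c
  | .reg r => s.reg r
  | .read a e => s.arr a (e.eval s)
  | .add e₁ e₂ => e₁.eval s + e₂.eval s
  | .sub e₁ e₂ => e₁.eval s - e₂.eval s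

/-- The number of steps needed to evaluate an expression: one for each operation in it. -/
def Expr.cost : Expr → ℕ
  | .const _ => 1
  | .reg _ => 1
  | .read _ e => e.cost + 1
  | .add e₁ e₂ => e₁.cost + e₂.cost + 1
  | .sub e₁ e₂ => e₁.cost + e₂.cost + 1

/-- Programs. -/
inductive Program where
  | /-- register `r` := `e` -/
    set (r : ℕ) (e : Expr)
  | /-- cell of array `a` at index `i` := `e` -/
    store (a : ℕ) (i e : Expr)
  | seq (P Q : Program)
  | /-- run `P` if `e ≠ 0`, else `Q` -/
    cond (e : Expr) (P Q : Program)
  | /-- run `P` as long as `e ≠ 0` -/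
    loop (e : Expr) (P : Program)

/-- `Program.Run P s t s'`: started in state `s`, the program `P` halts after exactly `t` steps, in
state `s'`. -/
inductive Program.Run : Program → State → ℕ → State → Prop
  | set (r : ℕ) (e : Expr) (s : State) :
      Run (.set r e) s (e.cost + 1)
        { reg := Function.update s.reg r (e.eval s), arr := s.arr }
  | store (a : ℕ) (i e : Expr) (s : State) :
      Run (.store a i e) s (i.cost + e.cost + 1)
        { reg := s.reg
          arr := Function.update s.arr a (Function.update (s.arr a) (i.eval s) (e.eval s)) }
  | seq {P Q : Program} {s s' s'' : State} {t t' : ℕ} :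
      Run P s t s' → Run Q s' t' s'' → Run (.seq P Q) s (t + t') s''
  | cond_true {e : Expr} {P Q : Program} {s s' : State} {t : ℕ} :
      e.eval s ≠ 0 → Run P s t s' → Run (.cond e P Q) s (e.cost + 1 + t) s'
  | cond_false {e : Expr} {P Q : Program} {s s' : State} {t : ℕ} :
      e.eval s = 0 → Run Q s t s' → Run (.cond e P Q) s (e.cost + 1 + t) s'
  | loop_stop {e : Expr} {P : Program} {s : State} :
      e.eval s = 0 → Run (.loop e P) s (e.cost + 1) s
  | loop_step {e : Expr} {P : Program} {s s' s'' : State} {t t' : ℕ} :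
      e.eval s ≠ 0 → Run P s t s' → Run (.loop e P) s' t' s'' →
        Run (.loop e P) s (e.cost + 1 + t + t') s''

/-- The initial state on an input word: the word is in array `0`, its length in register `0`, and
everything else is `0`. -/
def initState (input : List ℕ) : State where
  reg := fun r => if r = 0 then input.length else 0
  arr := fun a i => if a = 0 then input.getD i 0 else 0

/-- The output word of a state: the first `k` cells of array `1`, with `k` in register `1`. -/
def State.output (s : State) : List ℕ :=
  (List.range (s.reg 1)).map (s.arr 1)

/-- On the word `input`, the program halts within `t` steps with the word `output`. -/
def Program.OutputsWithin (P : Program) (input output : List ℕ) (t : ℕ) : Prop :=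
  ∃ t' ≤ t, ∃ s' : State, P.Run (initState input) t' s' ∧ s'.output = output

/-! ### Simplicial homology with coefficients in `ℤ/2` -/

variable {m : ℕ}

/-- The simplices of `K` with exactly `k` vertices, i.e. those of dimension `k - 1`.  As the empty
set is not a face, there are none with `k = 0`. -/
abbrev Simplex (K : AbstractSimplicialComplex (Fin m)) (k : ℕ) : Type :=
  {σ : Finset (Fin m) // σ ∈ K ∧ σ.card = k}

noncomputable instance (K : AbstractSimplicialComplex (Fin m)) (k : ℕ) : Fintype (Simplex K k) :=
  Fintype.ofFinite _

/-- The group `C_d(K)` of `d`-chains: vectors over `ℤ/2` indexed by the `d`-dimensional simplices,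
which have `d + 1` vertices. -/
abbrev Chain (K : AbstractSimplicialComplex (Fin m)) (d : ℕ) : Type :=
  Simplex K (d + 1) → ZMod 2

/-- The boundary of a `d`-chain: the coefficient of a simplex `τ` with `d` vertices is the sum of the
coefficients of the `d`-simplices that have `τ` as a facet.  For `d = 0` the target is the zero
space. -/
noncomputable def boundary (K : AbstractSimplicialComplex (Fin m)) (d : ℕ) :
    Chain K d →ₗ[ZMod 2] (Simplex K d → ZMod 2) where
  toFun c := fun τ => ∑ σ : Simplex K (d + 1), if τ.1 ⊆ σ.1 then c σ else 0
  map_add' c c' := by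
    funext τ
    simp only [Pi.add_apply, ← Finset.sum_add_distrib]
    exact Finset.sum_congr rfl fun σ _ => by split_ifs <;> simp
  map_smul' a c := by
    funext τ
    simp only [Pi.smul_apply, smul_eq_mul, RingHom.id_apply, Finset.mul_sum]
    exact Finset.sum_congr rfl fun σ _ => by split_ifs <;> simp

/-- The group `Z_d(K)` of `d`-cycles. -/
noncomputable def cycles (K : AbstractSimplicialComplex (Fin m)) (d : ℕ) :
    Submodule (ZMod 2) (Chain K d) :=
  LinearMap.ker (boundary K d)

/-- The group `B_d(K)` of `d`-boundaries. -/
noncomputable def boundaries (K : AbstractSimplicialComplex (Fin m)) (d : ℕ) :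
    Submodule (ZMod 2) (Chain K d) :=
  LinearMap.range (boundary K (d + 1))

/-- The homology group `H_d(K)`, the cycles modulo the boundaries (which are cycles). -/
abbrev Homology (K : AbstractSimplicialComplex (Fin m)) (d : ℕ) : Type :=
  cycles K d ⧸ (boundaries K d).comap (cycles K d).subtype

/-- The homology class of a cycle. -/
noncomputable def homologyClass (K : AbstractSimplicialComplex (Fin m)) (d : ℕ) (z : cycles K d) :
    Homology K d :=
  Submodule.Quotient.mk z

/-! ### Geodesic distance and radius -/

/-- The `1`-skeleton of `K`, as a graph. -/
def oneSkeleton (K : AbstractSimplicialComplex (Fin m)) : SimpleGraph (Fin m) where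
  Adj p q := p ≠ q ∧ {p, q} ∈ K
  symm := ⟨fun p q h => ⟨h.1.symm, by rw [Finset.pair_comm]; exact h.2⟩⟩
  loopless := ⟨fun _ h => h.1 rfl⟩

/-- The discrete geodesic distance: the length of a shortest path in the `1`-skeleton, and `⊤` if
there is no path. -/
noncomputable def dist (K : AbstractSimplicialComplex (Fin m)) (p q : Fin m) : ℕ∞ :=
  (oneSkeleton K).edist p q

/-- The vertices of a chain: those of the simplices that occur in it. -/
def vert {K : AbstractSimplicialComplex (Fin m)} {d : ℕ} (c : Chain K d) : Set (Fin m) :=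
  {q | ∃ σ : Simplex K (d + 1), c σ ≠ 0 ∧ q ∈ σ.1}

/-- The radius of a chain: the least `r` such that all vertices of the chain have distance at most
`r` from some vertex `p` of the complex. -/
noncomputable def radius {K : AbstractSimplicialComplex (Fin m)} {d : ℕ} (c : Chain K d) : ℕ∞ :=
  ⨅ p : Fin m, ⨆ q ∈ vert c, dist K p q

/-- `z` is a representative cycle of minimal radius of the homology class `h`. -/
def IsMinRadiusCycle {K : AbstractSimplicialComplex (Fin m)} {d : ℕ} (h : Homology K d)
    (z : cycles K d) : Prop :=
  homologyClass K d z = h ∧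
    ∀ w : cycles K d, homologyClass K d w = h → radius (z : Chain K d) ≤ radius (w : Chain K d)

/-! ### Complexes and chains as words -/

/-- `L` lists the simplices of `K`, each exactly once, in any order. -/
def Enumerates (L : List (Finset (Fin m))) (K : AbstractSimplicialComplex (Fin m)) : Prop :=
  L.Nodup ∧ ∀ σ : Finset (Fin m), σ ∈ L ↔ σ ∈ K

/-- A simplex as a word: the number of its vertices, followed by its vertices in increasing order. -/
def simplexWord (σ : Finset (Fin m)) : List ℕ :=
  σ.card :: (σ.sort (· ≤ ·)).map Fin.val

open Classical in
/-- The coefficient, `0` or `1`, of a simplex in a `d`-chain. -/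
noncomputable def coeff {K : AbstractSimplicialComplex (Fin m)} {d : ℕ} (c : Chain K d)
    (σ : Finset (Fin m)) : ℕ :=
  if h : σ ∈ K ∧ σ.card = d + 1 then (c ⟨σ, h⟩).val else 0

/-- A `d`-chain as a word: its coefficients at the simplices of the list `L`. -/
noncomputable def chainWord {K : AbstractSimplicialComplex (Fin m)} {d : ℕ}
    (L : List (Finset (Fin m))) (c : Chain K d) : List ℕ :=
  L.map (coeff c)

/-- The input word for a complex, given by the list `L` of its simplices, and a `d`-chain `c`: the
number of vertices, the dimension `d`, the number of simplices, the simplices, the coefficients of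
`c`. -/
noncomputable def inputWord {K : AbstractSimplicialComplex (Fin m)} {d : ℕ}
    (L : List (Finset (Fin m))) (c : Chain K d) : List ℕ :=
  m :: d :: L.length :: (L.flatMap simplexWord ++ chainWord L c)

end MinRadius

/-! A cycle has radius at most `r < ∞` exactly when some ball of radius `r` around a vertex contains
all its simplices. A shortest path in the 1-skeleton repeats no vertex, so finite radii are less
than `m`, and only polynomially many balls matter. For one ball the question is linear algebra over
`ZMod 2`: does `z₀ + B_d` contain a vector that vanishes on all simplices outside the ball?

This is decided by column elimination on the boundary matrix. For each row `k` outside the ball, a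
column `u` with a nonzero entry there is added to every column, and to the current vector `y`, whose
`k`-th entry is nonzero. The map `x ↦ x + x k • u` fixes every `v` vanishing outside the ball, so `v
- y` stays in the column span although that span may shrink (`Eliminated.step`). In the end all
columns vanish outside the ball; hence if any solution `v` exists, `y` is one
(`Eliminated.apply_eq_zero`). Throughout, `y` changes only by boundaries, so it remains a cycle of
the class, by `∂∂ = 0` (`boundaries_le_cycles`).

Balls are tried in order of decreasing radius and each success replaces the stored cycle. What fits
a small ball fits the larger ones, so the final cycle fits a ball no larger than any feasible one
(`iter_tryRadius_spec`), which is minimality (`exists_isMinRadiusCycle`).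

For the running time, the procedure is written in a small language of array assignments, sums and
loops over `0, …, w - 1`, where `w` is the length of the input word. A verified compiler turns it
into a machine program whose time is a polynomial in `w` obtained by structural recursion
(`Term.compile_ends`, `Stmt.compile_ends`). Every vertex is a simplex, so `m ≤ n` and `w ≤ 3 + n (n
+ 1) + n`. -/

namespace MinRadius

/-! ### Timed program logic and a verified compiler for array statements. -/

/-! ### Running time of programs -/

/-- Started in state `s`, the program halts within `T` steps in a state that satisfies `Q`. -/
def Program.Ends (P : Program) (s : State) (T : ℕ) (Q : State → Prop) : Prop :=
  ∃ t ≤ T, ∃ s', P.Run s t s' ∧ Q s'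

/-- The state `s` with `x` in register `r`. -/
def State.setReg (s : State) (r x : ℕ) : State where
  reg := Function.update s.reg r x
  arr := s.arr

/-- The state `s` with `x` in cell `i` of array `a`. -/
def State.setArr (s : State) (a i x : ℕ) : State where
  reg := s.reg
  arr := Function.update s.arr a (Function.update (s.arr a) i x)

@[simp] theorem State.setReg_arr (s : State) (r x : ℕ) : (s.setReg r x).arr = s.arr := rfl

@[simp] theorem State.setArr_reg (s : State) (a i x : ℕ) : (s.setArr a i x).reg = s.reg := rfl

@[simp] theorem State.setReg_reg_self (s : State) (r x : ℕ) : (s.setReg r x).reg r = x := by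
  simp [State.setReg]

theorem State.setReg_reg_of_ne (s : State) {r r' : ℕ} (x : ℕ) (h : r' ≠ r) :
    (s.setReg r x).reg r' = s.reg r' := by
  simp [State.setReg, h]

theorem State.setArr_arr (s : State) (a i x b j : ℕ) :
    (s.setArr a i x).arr b j = if b = a ∧ j = i then x else s.arr b j := by
  by_cases hb : b = a
  · subst hb
    simp [State.setArr, Function.update_apply]
  · simp [State.setArr, hb]

theorem State.setArr_arr_of_ne (s : State) {a b : ℕ} (i x : ℕ) (h : b ≠ a) :
    (s.setArr a i x).arr b = s.arr b := by
  simp [State.setArr, h]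

namespace Program.Ends

variable {P P' : Program} {s : State} {T T' T'' : ℕ} {Q Q' : State → Prop}

theorem mono (h : P.Ends s T Q) (hT : T ≤ T') (hQ : ∀ s, Q s → Q' s) : P.Ends s T' Q' := by
  obtain ⟨t, ht, s', hr, hs⟩ := h
  exact ⟨t, ht.trans hT, s', hr, hQ _ hs⟩

theorem set {r : ℕ} {e : Expr} (hT : e.cost + 1 ≤ T) (h : Q (s.setReg r (e.eval s))) :
    (Program.set r e).Ends s T Q :=
  ⟨_, hT, _, .set r e s, h⟩

theorem store {a : ℕ} {i e : Expr} (hT : i.cost + e.cost + 1 ≤ T)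
    (h : Q (s.setArr a (i.eval s) (e.eval s))) : (Program.store a i e).Ends s T Q :=
  ⟨_, hT, _, .store a i e s, h⟩

theorem seq (h : P.Ends s T (fun s' => P'.Ends s' T' Q)) (hT : T + T' ≤ T'') :
    (Program.seq P P').Ends s T'' Q := by
  obtain ⟨t, ht, s', hr, t', ht', s'', hr', hs⟩ := h
  exact ⟨t + t', by omega, s'', .seq hr hr', hs⟩

theorem cond {e : Expr} (h : e.eval s ≠ 0 → P.Ends s T Q) (h' : e.eval s = 0 → P'.Ends s T' Q)
    (hT : e.cost + 1 + T + T' ≤ T'') : (Program.cond e P P').Ends s T'' Q := by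
  by_cases he : e.eval s = 0
  · obtain ⟨t, ht, s', hr, hs⟩ := h' he
    exact ⟨e.cost + 1 + t, by omega, s', .cond_false he hr, hs⟩
  · obtain ⟨t, ht, s', hr, hs⟩ := h he
    exact ⟨e.cost + 1 + t, by omega, s', .cond_true he hr, hs⟩

end Program.Ends

/-- Run `P` with register `v` set to `0, 1, …, w - 1`, where `w` is the content of register `0`. -/
def forLoop (v : ℕ) (P : Program) : Program :=
  .seq (.set v (.const 0))
    (.loop (.sub (.reg 0) (.reg v)) (.seq P (.set v (.add (.reg v) (.const 1)))))

/-- Loop rule with invariant `I`. Each round costs 4 for the test and 4 for the increment besides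
the body; the remaining 6 pay for the initialisation and the last test. -/
theorem Program.Ends.forLoop {v w T T' : ℕ} {P : Program} {s : State} {I : ℕ → State → Prop}
    (h0 : I 0 (s.setReg v 0)) (hI : ∀ k s, I k s → s.reg 0 = w ∧ s.reg v = k)
    (step : ∀ k < w, ∀ s, I k s → P.Ends s T (fun s' => s'.reg v = k ∧ I (k + 1) (s'.setReg v (k + 1))))
    (hT : w * (T + 8) + 6 ≤ T') : (MinRadius.forLoop v P).Ends s T' (I w) := by
  have key : ∀ c k s, c + k = w → I k s →
      (Program.loop (.sub (.reg 0) (.reg v)) (.seq P (.set v (.add (.reg v) (.const 1))))).Ends s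
        (c * (T + 8) + 4) (I w) := by
    intro c
    induction c with
    | zero =>
      intro k s hk hs
      obtain ⟨h1, h2⟩ := hI k s hs
      refine ⟨_, ?_, s, Program.Run.loop_stop ?_, ?_⟩
      · simp [Expr.cost]
      · simp [Expr.eval]
        omega
      · have : k = w := by omega
        exact this ▸ hs
    | succ c ih =>
      intro k s hk hs
      obtain ⟨h1, h2⟩ := hI k s hs
      obtain ⟨t, ht, s', hr, hv, hs'⟩ := step k (by omega) s hs
      have hset := Program.Run.set v (.add (.reg v) (.const 1)) s'
      have hs1 : I (k + 1) (s'.setReg v (Expr.eval s' (.add (.reg v) (.const 1)))) := by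
        simpa [Expr.eval, hv] using hs'
      obtain ⟨t', ht', s'', hr', hs''⟩ := ih (k + 1) _ (by omega) hs1
      refine ⟨_, ?_, s'', .loop_step ?_ (.seq hr hset) hr', hs''⟩
      · simp only [Expr.cost]
        ring_nf at ht' ⊢
        omega
      · simp [Expr.eval]
        omega
  refine Program.Ends.seq (T := 2) (T' := w * (T + 8) + 4) (.set (by simp [Expr.cost]) ?_) (by omega)
  exact key w 0 _ (by omega) h0

/-! ### A language of simultaneous array assignments

Terms and statements refer to two-dimensional arrays, all index variables range over `0, …, w - 1`
for a fixed size `w`, and variables are de Bruijn indices. -/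

/-- The contents of the arrays. -/
abbrev Store : Type := ℕ → ℕ → ℕ → ℕ

/-- Terms.  `sum t` is the sum of the values of `t` over all values of its variable. -/
inductive Term where
  | const (c : ℕ)
  | var (i : ℕ)
  | get (a i j : ℕ)
  | add (t₁ t₂ : Term)
  | sub (t₁ t₂ : Term)
  | ite (t₁ t₂ t₃ : Term)
  | sum (t : Term)

/-- The value of a term. -/
def Term.eval (w : ℕ) (μ : Store) : List ℕ → Term → ℕ
  | _, .const c => c
  | ρ, .var i => ρ.getD i 0
  | ρ, .get a i j => μ a (ρ.getD i 0) (ρ.getD j 0)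
  | ρ, .add t₁ t₂ => t₁.eval w μ ρ + t₂.eval w μ ρ
  | ρ, .sub t₁ t₂ => t₁.eval w μ ρ - t₂.eval w μ ρ
  | ρ, .ite t₁ t₂ t₃ => if t₁.eval w μ ρ ≠ 0 then t₂.eval w μ ρ else t₃.eval w μ ρ
  | ρ, .sum t => ∑ k ∈ Finset.range w, t.eval w μ (k :: ρ)

/-- Statements.  `assign a t` sets all entries of array `a` simultaneously, the row being variable
`1` and the column variable `0` in `t`; `iter S` runs `S` for all values of its variable. -/
inductive Stmt where
  | assign (a : ℕ) (t : Term)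
  | seq (S₁ S₂ : Stmt)
  | iter (S : Stmt)

/-- The effect of a statement. -/
def Stmt.exec (w : ℕ) : List ℕ → Stmt → Store → Store
  | ρ, .assign a t, μ => Function.update μ a fun i j => t.eval w μ (j :: i :: ρ)
  | ρ, .seq S₁ S₂, μ => S₂.exec w ρ (S₁.exec w ρ μ)
  | ρ, .iter S, μ => Nat.rec (motive := fun _ => Store) μ (fun k μ => S.exec w (k :: ρ) μ) w

/-! ### Compilation -/

/-- The array that holds array `a` of a store; array `2` is a table of multiples of the size, and
array `3` holds temporary values. -/
def arrayNo (a : ℕ) : ℕ := if a < 2 then a else a + 2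

theorem arrayNo_injective : Function.Injective arrayNo := by
  intro a b h
  simp only [arrayNo] at h
  split_ifs at h <;> omega

theorem arrayNo_ne_two (a : ℕ) : arrayNo a ≠ 2 := by
  simp only [arrayNo]
  split_ifs <;> omega

theorem arrayNo_ne_three (a : ℕ) : arrayNo a ≠ 3 := by
  simp only [arrayNo]
  split_ifs <;> omega

/-- The register of the variable bound at depth `l`. -/
def varReg (l : ℕ) : ℕ := 2 * l + 2

/-- The registers for intermediate values. -/
def tmpReg (c : ℕ) : ℕ := 2 * c + 1

/-- The variable with de Bruijn index `i` at depth `D`. -/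
def varExpr (D i : ℕ) : Expr := if i < D then .reg (varReg (D - 1 - i)) else .const 0

/-- The program that computes the value of a term at depth `D` in the `c`-th temporary register. -/
def Term.compile : ℕ → ℕ → Term → Program
  | _, c, .const x => .set (tmpReg c) (.const x)
  | D, c, .var i => .set (tmpReg c) (varExpr D i)
  | D, c, .get a i j =>
    .set (tmpReg c) (.read (arrayNo a) (.add (.read 2 (varExpr D i)) (varExpr D j)))
  | D, c, .add t₁ t₂ => .seq (t₁.compile D c) (.seq (t₂.compile D (c + 1))
      (.set (tmpReg c) (.add (.reg (tmpReg c)) (.reg (tmpReg (c + 1))))))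
  | D, c, .sub t₁ t₂ => .seq (t₁.compile D c) (.seq (t₂.compile D (c + 1))
      (.set (tmpReg c) (.sub (.reg (tmpReg c)) (.reg (tmpReg (c + 1))))))
  | D, c, .ite t₁ t₂ t₃ => .seq (t₁.compile D c)
      (.cond (.reg (tmpReg c)) (t₂.compile D c) (t₃.compile D c))
  | D, c, .sum t => .seq (.set (tmpReg c) (.const 0)) (forLoop (varReg D)
      (.seq (t.compile (D + 1) (c + 1))
        (.set (tmpReg c) (.add (.reg (tmpReg c)) (.reg (tmpReg (c + 1)))))))

open Polynomial in
/-- A bound for the time to compute a term. -/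
noncomputable def Term.time : Term → ℕ[X]
  | .const _ => 2
  | .var _ => 2
  | .get _ _ _ => 6
  | .add t₁ t₂ => t₁.time + t₂.time + 4
  | .sub t₁ t₂ => t₁.time + t₂.time + 4
  | .ite t₁ t₂ t₃ => t₁.time + t₂.time + t₃.time + 2
  | .sum t => X * (t.time + 12) + 8

/-- Fill array `b` with the values that `P` computes in the first temporary register. -/
def fill (D b : ℕ) (P : Program) : Program :=
  forLoop (varReg D) (forLoop (varReg (D + 1)) (.seq P
    (.store b (.add (.read 2 (.reg (varReg D))) (.reg (varReg (D + 1)))) (.reg (tmpReg 0)))))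

/-- The program of a statement at depth `D`. -/
def Stmt.compile : ℕ → Stmt → Program
  | D, .assign a t => .seq (fill D 3 (t.compile (D + 2) 0))
      (fill D (arrayNo a) (.set (tmpReg 0)
        (.read 3 (.add (.read 2 (.reg (varReg D))) (.reg (varReg (D + 1)))))))
  | D, .seq S₁ S₂ => .seq (S₁.compile D) (S₂.compile D)
  | D, .iter S => forLoop (varReg D) (S.compile (D + 1))

open Polynomial in
/-- A bound for the time to run a statement. -/
noncomputable def Stmt.time : Stmt → ℕ[X]
  | .assign _ t => (X * (X * (t.time + 14) + 14) + 6) + (X * (X * (6 + 14) + 14) + 6)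
  | .seq S₁ S₂ => S₁.time + S₂.time
  | .iter S => X * (S.time + 8) + 6

/-- The registers up to depth `D` and up to the `c`-th temporary register agree. -/
def Agree (D c : ℕ) (s s' : State) : Prop :=
  ∀ r, (r % 2 = 0 ∧ r < 2 * D + 2) ∨ (r % 2 = 1 ∧ r < 2 * c + 1) → s'.reg r = s.reg r

theorem Agree.trans {D c D' c' D'' c'' : ℕ} {s s' s'' : State} (h : Agree D c s s')
    (h' : Agree D' c' s' s'') (hD : D'' ≤ D) (hD' : D'' ≤ D') (hc : c'' ≤ c) (hc' : c'' ≤ c') :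
    Agree D'' c'' s s'' := by
  intro r hr
  rw [h' r (by omega), h r (by omega)]

/-- Temporaries are the odd registers, while variables and the size `w` occupy even ones, so the two
families never collide. -/
theorem Agree.setReg_tmp {D c c' : ℕ} {s s' : State} {x : ℕ} (h : Agree D c s s') (hc : c ≤ c') :
    Agree D c s (s'.setReg (tmpReg c') x) := by
  intro r hr
  rw [State.setReg_reg_of_ne _ _ (by unfold tmpReg; omega), h r hr]

theorem Agree.setReg_var {D D' c : ℕ} {s s' : State} {x : ℕ} (h : Agree D c s s') (hD : D ≤ D') :
    Agree D c s (s'.setReg (varReg D') x) := by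
  intro r hr
  rw [State.setReg_reg_of_ne _ _ (by unfold varReg; omega), h r hr]

theorem Agree.rfl {D c : ℕ} {s : State} : Agree D c s s := fun _ _ => Eq.refl _

theorem Agree.zero {D c : ℕ} {s s' : State} (h : Agree D c s s') : s'.reg 0 = s.reg 0 :=
  h 0 (by omega)

theorem Agree.var {D c l : ℕ} {s s' : State} (h : Agree D c s s') (hl : l < D) :
    s'.reg (varReg l) = s.reg (varReg l) :=
  h _ (by unfold varReg; omega)

theorem Agree.tmp {D c l : ℕ} {s s' : State} (h : Agree D c s s') (hl : l < c) :
    s'.reg (tmpReg l) = s.reg (tmpReg l) :=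
  h _ (by unfold tmpReg; omega)

/-- The state `s` represents the variables `ρ` and the store `μ`. -/
structure Represents (w : ℕ) (ρ : List ℕ) (μ : Store) (s : State) : Prop where
  size : s.reg 0 = w
  vars : ∀ i < ρ.length, s.reg (varReg (ρ.length - 1 - i)) = ρ.getD i 0
  table : ∀ i < w, s.arr 2 i = i * w
  arrs : ∀ a, ∀ i < w, ∀ j < w, s.arr (arrayNo a) (i * w + j) = μ a i j

namespace Represents

variable {w : ℕ} {ρ : List ℕ} {μ : Store} {s s' : State}

theorem of_agree {c : ℕ} (h : Represents w ρ μ s) (ha : Agree ρ.length c s s')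
    (harr : s'.arr = s.arr) : Represents w ρ μ s' where
  size := by rw [ha.zero, h.size]
  vars i hi := by rw [ha.var (by omega), h.vars i hi]
  table i hi := by rw [harr, h.table i hi]
  arrs a i hi j hj := by rw [harr, h.arrs a i hi j hj]

/-- Registers are numbered by binding depth, not by de Bruijn index, so a new binder leaves the
older variables in place. -/
theorem push {k : ℕ} (h : Represents w ρ μ s) (hk : s.reg (varReg ρ.length) = k) :
    Represents w (k :: ρ) μ s where
  size := h.size
  vars i hi := by
    rcases i with _ | i
    · simpa using hk
    · simp only [List.length_cons] at hi
      simp only [List.length_cons, List.getD_cons_succ]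
      rw [← h.vars i (by omega)]
      congr 2
      omega
  table := h.table
  arrs := h.arrs

theorem pop {k : ℕ} (h : Represents w (k :: ρ) μ s) : Represents w ρ μ s where
  size := h.size
  vars i hi := by
    have := h.vars (i + 1) (by simpa using hi)
    simp only [List.length_cons, List.getD_cons_succ] at this
    rw [← this]
    congr 2
    omega
  table := h.table
  arrs := h.arrs

theorem setReg_varReg {x : ℕ} (h : Represents w ρ μ s) :
    Represents w ρ μ (s.setReg (varReg ρ.length) x) :=
  h.of_agree (c := 0) (Agree.rfl.setReg_var le_rfl) rfl

theorem eval_varExpr (h : Represents w ρ μ s) (i : ℕ) :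
    (varExpr ρ.length i).eval s = ρ.getD i 0 := by
  unfold varExpr
  split_ifs with hi
  · exact h.vars i hi
  · rw [List.getD_eq_default _ _ (by omega)]
    rfl

end Represents

theorem varExpr_cost (D i : ℕ) : (varExpr D i).cost = 1 := by
  unfold varExpr
  split_ifs <;> rfl

theorem getD_lt {w : ℕ} (hw : 0 < w) {ρ : List ℕ} (hρ : ∀ x ∈ ρ, x < w) (i : ℕ) :
    ρ.getD i 0 < w := by
  by_cases hi : i < ρ.length
  · rw [List.getD_eq_getElem _ _ hi]
    exact hρ _ (List.getElem_mem hi)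
  · rwa [List.getD_eq_default _ _ (by omega)]

/-- Structural induction. A second operand is computed in temporary `c + 1`, and agreement below `c
+ 1` protects the first result. Positivity of `w` makes `0`, the default value of an unbound
variable, a legal index. -/
theorem Term.compile_ends {w : ℕ} (hw : 0 < w) {μ : Store} (t : Term) :
    ∀ (ρ : List ℕ) (c : ℕ) (s : State), (∀ x ∈ ρ, x < w) → Represents w ρ μ s →
      (t.compile ρ.length c).Ends s (t.time.eval w) fun s' =>
        s'.arr = s.arr ∧ s'.reg (tmpReg c) = t.eval w μ ρ ∧ Agree ρ.length c s s' := by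
  induction t with
  | const x =>
    intro ρ c s _ _
    refine .set (by simp [Expr.cost, Term.time]) ⟨rfl, ?_, Agree.rfl.setReg_tmp le_rfl⟩
    simp [Expr.eval, Term.eval]
  | var i =>
    intro ρ c s _ h
    refine .set (by simp [varExpr_cost, Term.time]) ⟨rfl, ?_, Agree.rfl.setReg_tmp le_rfl⟩
    simp [h.eval_varExpr, Term.eval]
  | get a i j =>
    intro ρ c s hρ h
    refine .set (by simp [varExpr_cost, Expr.cost, Term.time])
      ⟨rfl, ?_, Agree.rfl.setReg_tmp le_rfl⟩
    have hi := getD_lt hw hρ i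
    have hj := getD_lt hw hρ j
    simp only [Expr.eval, h.eval_varExpr, State.setReg_reg_self, h.table _ hi, Term.eval,
      h.arrs a _ hi _ hj]
  | add t₁ t₂ ih₁ ih₂ =>
    intro ρ c s hρ h
    refine .seq (T' := t₂.time.eval w + 4) ((ih₁ ρ c s hρ h).mono le_rfl ?_)
      (by simp [Term.time]; omega)
    rintro s₁ ⟨ha₁, hv₁, hg₁⟩
    refine .seq (T' := 4) ((ih₂ ρ (c + 1) s₁ hρ (h.of_agree hg₁ ha₁)).mono le_rfl ?_) le_rfl
    rintro s₂ ⟨ha₂, hv₂, hg₂⟩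
    refine .set (by simp [Expr.cost])
      ⟨by simp [ha₂, ha₁], ?_, (hg₁.trans hg₂ le_rfl le_rfl le_rfl (by omega)).setReg_tmp le_rfl⟩
    simp [Expr.eval, Term.eval, hv₂, hg₂.tmp (Nat.lt_succ_self c), hv₁]
  | sub t₁ t₂ ih₁ ih₂ =>
    intro ρ c s hρ h
    refine .seq (T' := t₂.time.eval w + 4) ((ih₁ ρ c s hρ h).mono le_rfl ?_)
      (by simp [Term.time]; omega)
    rintro s₁ ⟨ha₁, hv₁, hg₁⟩
    refine .seq (T' := 4) ((ih₂ ρ (c + 1) s₁ hρ (h.of_agree hg₁ ha₁)).mono le_rfl ?_) le_rfl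
    rintro s₂ ⟨ha₂, hv₂, hg₂⟩
    refine .set (by simp [Expr.cost])
      ⟨by simp [ha₂, ha₁], ?_, (hg₁.trans hg₂ le_rfl le_rfl le_rfl (by omega)).setReg_tmp le_rfl⟩
    simp [Expr.eval, Term.eval, hv₂, hg₂.tmp (Nat.lt_succ_self c), hv₁]
  | ite t₁ t₂ t₃ ih₁ ih₂ ih₃ =>
    intro ρ c s hρ h
    refine .seq (T' := t₂.time.eval w + t₃.time.eval w + 2) ((ih₁ ρ c s hρ h).mono le_rfl ?_)
      (by simp [Term.time]; omega)
    rintro s₁ ⟨ha₁, hv₁, hg₁⟩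
    refine .cond (T := t₂.time.eval w) (T' := t₃.time.eval w) ?_ ?_ (by simp [Expr.cost]; omega)
    · intro he
      refine (ih₂ ρ c s₁ hρ (h.of_agree hg₁ ha₁)).mono le_rfl ?_
      rintro s₂ ⟨ha₂, hv₂, hg₂⟩
      refine ⟨by rw [ha₂, ha₁], ?_, hg₁.trans hg₂ le_rfl le_rfl le_rfl le_rfl⟩
      have : t₁.eval w μ ρ ≠ 0 := by rwa [← hv₁]
      simp [Term.eval, hv₂, this]
    · intro he
      refine (ih₃ ρ c s₁ hρ (h.of_agree hg₁ ha₁)).mono le_rfl ?_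
      rintro s₂ ⟨ha₂, hv₂, hg₂⟩
      refine ⟨by rw [ha₂, ha₁], ?_, hg₁.trans hg₂ le_rfl le_rfl le_rfl le_rfl⟩
      have : t₁.eval w μ ρ = 0 := by rwa [← hv₁]
      simp [Term.eval, hv₂, this]
  | sum t ih =>
    intro ρ c s hρ h
    refine .seq (T := 2) (T' := w * (t.time.eval w + 12) + 6) (.set (by simp [Expr.cost]) ?_)
      (by simp [Term.time]; omega)
    refine (Program.Ends.forLoop (w := w) (T := t.time.eval w + 4) (I := fun k s' => s'.arr = s.arr ∧
      s'.reg (varReg ρ.length) = k ∧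
      s'.reg (tmpReg c) = ∑ i ∈ Finset.range k, t.eval w μ (i :: ρ) ∧ Agree ρ.length c s s')
      ?_ ?_ ?_ le_rfl).mono le_rfl ?_
    · refine ⟨rfl, by simp, ?_, (Agree.rfl.setReg_tmp le_rfl).setReg_var le_rfl⟩
      rw [State.setReg_reg_of_ne _ _ (by unfold varReg tmpReg; omega)]
      simp [Expr.eval]
    · rintro k s' ⟨_, hk, _, hg⟩
      exact ⟨by rw [hg.zero, h.size], hk⟩
    · rintro k hk s₁ ⟨ha₁, hk₁, hv₁, hg₁⟩
      refine .seq (T' := 4) ((ih (k :: ρ) (c + 1) s₁ (by simpa using ⟨hk, hρ⟩)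
        ((h.of_agree hg₁ ha₁).push hk₁)).mono le_rfl ?_) le_rfl
      rintro s₂ ⟨ha₂, hv₂, hg₂⟩
      simp only [List.length_cons] at hg₂
      refine .set (by simp [Expr.cost]) ⟨?_, by simp [ha₂, ha₁], by simp, ?_, ?_⟩
      · rw [State.setReg_reg_of_ne _ _ (by unfold varReg tmpReg; omega),
          hg₂.var (Nat.lt_succ_self _), hk₁]
      · rw [State.setReg_reg_of_ne _ _ (by unfold varReg tmpReg; omega), State.setReg_reg_self,
          Finset.sum_range_succ]
        simp [Expr.eval, hv₂, hg₂.tmp (Nat.lt_succ_self c), hv₁]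
      · exact ((hg₁.trans hg₂ le_rfl (by omega) le_rfl (by omega)).setReg_tmp le_rfl).setReg_var
          le_rfl
    · rintro s' ⟨ha, _, hv, hg⟩
      exact ⟨ha, hv, hg⟩

/-- Row-major addresses are unambiguous, so storing one matrix entry does not disturb another. -/
theorem mul_add_inj {w i j i' j' : ℕ} (hj : j < w) (hj' : j' < w)
    (h : i * w + j = i' * w + j') : i = i' ∧ j = j' := by
  have hw : 0 < w := by omega
  have h1 : (i * w + j) / w = i := by
    rw [mul_comm, Nat.mul_add_div hw, Nat.div_eq_of_lt hj, add_zero]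
  have h2 : (i' * w + j') / w = i' := by
    rw [mul_comm, Nat.mul_add_div hw, Nat.div_eq_of_lt hj', add_zero]
  have h3 : i = i' := by rw [← h1, ← h2, h]
  subst h3
  exact ⟨rfl, by omega⟩

/-- The program `P` may rely on every array except `b`, which is partly overwritten when it runs.
The condition `b ≠ 2` protects the table of multiples used for addressing. -/
theorem fill_ends {w D b T : ℕ} {P : Program} {f : ℕ → ℕ → ℕ} {s : State} (hb : b ≠ 2)
    (hsize : s.reg 0 = w) (htable : ∀ i < w, s.arr 2 i = i * w)
    (hP : ∀ s' i j, i < w → j < w → Agree D 0 s s' → (∀ a ≠ b, s'.arr a = s.arr a) →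
      s'.reg (varReg D) = i → s'.reg (varReg (D + 1)) = j →
      P.Ends s' T fun s'' => s''.arr = s'.arr ∧ s''.reg (tmpReg 0) = f i j ∧ Agree (D + 2) 0 s' s'') :
    (fill D b P).Ends s (w * (w * (T + 14) + 14) + 6) fun s' =>
      Agree D 0 s s' ∧ (∀ a ≠ b, s'.arr a = s.arr a) ∧
        ∀ i < w, ∀ j < w, s'.arr b (i * w + j) = f i j := by
  refine (Program.Ends.forLoop (w := w) (T := w * (T + 14) + 6) (I := fun k s' => Agree D 0 s s' ∧
    (∀ a ≠ b, s'.arr a = s.arr a) ∧ s'.reg (varReg D) = k ∧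
    ∀ i < k, ∀ j < w, s'.arr b (i * w + j) = f i j) ?_ ?_ ?_ le_rfl).mono le_rfl ?_
  · exact ⟨Agree.rfl.setReg_var le_rfl, fun _ _ => rfl, by simp, by simp⟩
  · rintro k s' ⟨hg, _, hk, _⟩
    exact ⟨by rw [hg.zero, hsize], hk⟩
  · rintro k hk s₁ ⟨hg₁, ha₁, hk₁, hf₁⟩
    refine (Program.Ends.forLoop (w := w) (T := T + 6) (I := fun l s' => Agree D 0 s s' ∧
      (∀ a ≠ b, s'.arr a = s.arr a) ∧ s'.reg (varReg D) = k ∧ s'.reg (varReg (D + 1)) = l ∧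
      (∀ i < k, ∀ j < w, s'.arr b (i * w + j) = f i j) ∧
      ∀ j < l, s'.arr b (k * w + j) = f k j) ?_ ?_ ?_ le_rfl).mono le_rfl ?_
    · refine ⟨hg₁.setReg_var (by omega), ha₁, ?_, by simp, hf₁, by simp⟩
      rw [State.setReg_reg_of_ne _ _ (by unfold varReg; omega), hk₁]
    · rintro l s' ⟨hg, _, _, hl, _⟩
      exact ⟨by rw [hg.zero, hsize], hl⟩
    · rintro l hl s₂ ⟨hg₂, ha₂, hk₂, hl₂, hf₂, hfk₂⟩
      refine .seq (T' := 6) ((hP s₂ k l hk hl hg₂ ha₂ hk₂ hl₂).mono le_rfl ?_) le_rfl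
      rintro s₃ ⟨ha₃, hv₃, hg₃⟩
      have hk₃ : s₃.reg (varReg D) = k := by rw [hg₃.var (by omega), hk₂]
      have hl₃ : s₃.reg (varReg (D + 1)) = l := by rw [hg₃.var (by omega), hl₂]
      have hidx : Expr.eval s₃ (.add (.read 2 (.reg (varReg D))) (.reg (varReg (D + 1))))
          = k * w + l := by
        simp only [Expr.eval, hk₃, hl₃, ha₃]
        rw [ha₂ 2 hb.symm, htable k hk]
      refine .store (by simp [Expr.cost]) ?_
      rw [hidx]
      refine ⟨hl₃, ?_, ?_, ?_, by simp, ?_, ?_⟩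
      · refine Agree.setReg_var ?_ (by omega)
        exact hg₂.trans hg₃ le_rfl (by omega) le_rfl le_rfl
      · intro a ha
        rw [State.setReg_arr, State.setArr_arr_of_ne _ _ _ ha, ha₃, ha₂ a ha]
      · rw [State.setReg_reg_of_ne _ _ (by unfold varReg; omega)]
        exact hk₃
      · intro i hi j hj
        rw [State.setReg_arr, State.setArr_arr, if_neg, ha₃, hf₂ i hi j hj]
        rintro ⟨_, h⟩
        have := mul_add_inj hj hl h
        omega
      · intro j hj
        rw [State.setReg_arr, State.setArr_arr]
        by_cases hjl : j = l
        · subst hjl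
          simp [Expr.eval, hv₃]
        · rw [if_neg (by rintro ⟨_, h⟩; omega), ha₃, hfk₂ j (by omega)]
    · rintro s' ⟨hg, ha, hk', _, hf, hfk⟩
      refine ⟨hk', hg.setReg_var le_rfl, ha, by simp, ?_⟩
      intro i hi j hj
      rcases Nat.lt_succ_iff_lt_or_eq.mp hi with hi | rfl
      · exact hf i hi j hj
      · exact hfk j hj
  · rintro s' ⟨hg, ha, _, hf⟩
    exact ⟨hg, ha, hf⟩

/-- An assignment to `a` may read `a` itself; simultaneity is obtained by first filling the scratch
array `3` and then copying it. -/
theorem Stmt.compile_ends {w : ℕ} (hw : 0 < w) (S : Stmt) :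
    ∀ (ρ : List ℕ) (μ : Store) (s : State), (∀ x ∈ ρ, x < w) → Represents w ρ μ s →
      (S.compile ρ.length).Ends s (S.time.eval w) (Represents w ρ (S.exec w ρ μ)) := by
  induction S with
  | assign a t =>
    intro ρ μ s hρ h
    refine .seq (T := w * (w * (t.time.eval w + 14) + 14) + 6) (T' := w * (w * (6 + 14) + 14) + 6)
      ((fill_ends (f := fun i j => t.eval w μ (j :: i :: ρ)) (by omega) h.size h.table ?_).mono
        le_rfl ?_) (by simp [Stmt.time])
    · intro s' i j hi hj hg ha hi' hj'
      have h' : Represents w (j :: i :: ρ) μ s' := by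
        refine Represents.push (Represents.push ⟨?_, ?_, ?_, ?_⟩ hi') hj'
        · rw [hg.zero, h.size]
        · intro i hi
          rw [hg.var (by omega), h.vars i hi]
        · intro i hi
          rw [ha 2 (by omega), h.table i hi]
        · intro a i hi j hj
          rw [ha _ (arrayNo_ne_three a), h.arrs a i hi j hj]
      exact t.compile_ends hw (j :: i :: ρ) 0 s' (by simpa using ⟨hj, hi, hρ⟩) h'
    · rintro s₁ ⟨hg₁, ha₁, hf₁⟩
      refine (fill_ends (w := w) (T := 6) (f := fun i j => t.eval w μ (j :: i :: ρ))
        (arrayNo_ne_two a) (by rw [hg₁.zero, h.size])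
        (fun i hi => by rw [ha₁ 2 (by omega), h.table i hi]) ?_).mono le_rfl ?_
      · intro s' i j hi hj hg ha hi' hj'
        refine .set (by simp [Expr.cost]) ⟨rfl, ?_, Agree.rfl.setReg_tmp le_rfl⟩
        simp only [State.setReg_reg_self, Expr.eval, hi', hj']
        rw [ha 2 (arrayNo_ne_two a).symm, ha 3 (arrayNo_ne_three a).symm, ha₁ 2 (by omega),
          h.table i hi, hf₁ i hi j hj]
      · rintro s₂ ⟨hg₂, ha₂, hf₂⟩
        refine ⟨?_, ?_, ?_, ?_⟩
        · rw [hg₂.zero, hg₁.zero, h.size]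
        · intro i hi
          rw [hg₂.var (by omega), hg₁.var (by omega), h.vars i hi]
        · intro i hi
          rw [ha₂ 2 (arrayNo_ne_two a).symm, ha₁ 2 (by omega), h.table i hi]
        · intro b i hi j hj
          by_cases hab : b = a
          · subst hab
            simp only [Stmt.exec, Function.update_self, hf₂ i hi j hj]
          · rw [ha₂ _ (fun h => hab (arrayNo_injective h)), ha₁ _ (arrayNo_ne_three b),
              h.arrs b i hi j hj]
            simp [Stmt.exec, hab]
  | seq S₁ S₂ ih₁ ih₂ =>
    intro ρ μ s hρ h
    exact .seq ((ih₁ ρ μ s hρ h).mono le_rfl fun s' h' => ih₂ ρ _ s' hρ h') (by simp [Stmt.time])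
  | iter S ih =>
    intro ρ μ s hρ h
    refine (Program.Ends.forLoop (w := w) (T := S.time.eval w) (I := fun k s' =>
      Represents w ρ (Nat.rec (motive := fun _ => Store) μ (fun k μ => S.exec w (k :: ρ) μ) k) s' ∧
      s'.reg (varReg ρ.length) = k) ?_ ?_ ?_ (by simp [Stmt.time])).mono le_rfl ?_
    · exact ⟨h.setReg_varReg, by simp⟩
    · rintro k s' ⟨h, hk⟩
      exact ⟨h.size, hk⟩
    · rintro k hk s' ⟨h, hk'⟩
      refine (ih (k :: ρ) _ s' (by simpa using ⟨hk, hρ⟩) (h.push hk')).mono le_rfl ?_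
      intro s'' h''
      refine ⟨?_, h''.pop.setReg_varReg, by simp⟩
      simpa using h''.vars 0 (by simp)
    · exact fun s' h => h.1

/-! ### Complete programs -/

/-- The word of length `n` in row `0` of array `1`, for a term `n`, after running `S` on the input
in row `0` of array `0`. -/
def wordProgram (S : Stmt) (n : Term) : Program :=
  .seq (forLoop (varReg 0) (.seq (.store 2 (.reg (varReg 0)) (.reg (tmpReg 0)))
    (.set (tmpReg 0) (.add (.reg (tmpReg 0)) (.reg 0)))))
    (.seq (S.compile 0) (n.compile 0 0))

open Polynomial in
/-- A bound for the time of a program, in terms of the length of the input. -/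
noncomputable def wordTime (S : Stmt) (n : Term) : ℕ[X] :=
  X * 15 + 6 + (S.time + n.time)

/-- The store with the input word in row `0` of array `0`. -/
def initStore (input : List ℕ) : Store :=
  fun a i j => if a = 0 ∧ i = 0 then input.getD j 0 else 0

theorem wordProgram_outputsWithin (S : Stmt) (n : Term) (input : List ℕ) (hw : 0 < input.length)
    (hn : n.eval input.length (S.exec input.length [] (initStore input)) [] ≤ input.length) :
    (wordProgram S n).OutputsWithin input
      ((List.range (n.eval input.length (S.exec input.length [] (initStore input)) [])).map
        (S.exec input.length [] (initStore input) 1 0))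
      ((wordTime S n).eval input.length) := by
  set w := input.length with hwdef
  set μ := S.exec w [] (initStore input) with hμ
  suffices h : (wordProgram S n).Ends (initState input) ((wordTime S n).eval w) (fun s =>
      s.reg 1 = n.eval w μ [] ∧ ∀ j < w, s.arr 1 j = μ 1 0 j) by
    obtain ⟨t, ht, s, hr, hs1, hs2⟩ := h
    refine ⟨t, ht, s, hr, ?_⟩
    rw [State.output, hs1]
    refine List.map_congr_left fun j hj => hs2 j ?_
    exact lt_of_lt_of_le (List.mem_range.mp hj) hn
  have hinit : (initState input).reg 0 = w := by simp [initState, hwdef]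
  refine .seq (T := w * 15 + 6) (T' := S.time.eval w + n.time.eval w)
    -- Without multiplication, the table `i * w` is built by repeatedly adding `w`.
    ((Program.Ends.forLoop (w := w) (T := 7) (I := fun k s' =>
      s'.reg 0 = w ∧ s'.reg (varReg 0) = k ∧ s'.reg (tmpReg 0) = k * w ∧
      (∀ a ≠ 2, s'.arr a = (initState input).arr a) ∧ ∀ i < k, s'.arr 2 i = i * w)
      ?_ ?_ ?_ le_rfl).mono le_rfl ?_) (by simp [wordTime])
  · refine ⟨?_, by simp, ?_, by simp, by simp⟩
    · rw [State.setReg_reg_of_ne _ _ (by unfold varReg; omega), hinit]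
    · rw [State.setReg_reg_of_ne _ _ (by unfold varReg tmpReg; omega)]
      simp [initState, tmpReg]
  · exact fun k s' h => ⟨h.1, h.2.1⟩
  · rintro k hk s₁ ⟨h0, hv, ht, ha, hf⟩
    refine .seq (T := 3) (T' := 4) (.store (by simp [Expr.cost])
      (.set (by simp [Expr.cost]) ⟨?_, ?_, by simp, ?_, ?_, ?_⟩)) le_rfl
    · rw [State.setReg_reg_of_ne _ _ (by unfold varReg tmpReg; omega)]
      exact hv
    · rw [State.setReg_reg_of_ne _ _ (by unfold varReg; omega),
        State.setReg_reg_of_ne _ _ (by unfold tmpReg; omega)]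
      exact h0
    · rw [State.setReg_reg_of_ne _ _ (by unfold varReg tmpReg; omega)]
      simp [Expr.eval, h0, ht, Nat.succ_mul]
    · intro a ha'
      simp only [State.setReg_arr]
      rw [State.setArr_arr_of_ne _ _ _ ha', ha a ha']
    · intro i hi
      simp only [State.setReg_arr]
      rw [State.setArr_arr]
      by_cases hik : i = k
      · subst hik
        simp [Expr.eval, hv, ht]
      · rw [if_neg (by simp [Expr.eval, hv, hik]), hf i (by omega)]
  · rintro s₁ ⟨h0, _, _, ha, hf⟩
    have h : Represents w [] (initStore input) s₁ := by
      refine ⟨h0, by simp, hf, ?_⟩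
      intro a i hi j hj
      rw [ha _ (arrayNo_ne_two a)]
      by_cases ha0 : a = 0
      · subst ha0
        rcases Nat.eq_zero_or_pos i with rfl | hi0
        · simp [initState, initStore, arrayNo]
        -- Rows after row `0` lie beyond the input word, where the machine's array is `0`.
        · have : w ≤ i * w + j := by nlinarith
          simp only [initState, initStore, arrayNo]
          rw [if_pos (by simp), if_neg (by omega), List.getD_eq_default _ _ this]
      · have : arrayNo a ≠ 0 := fun h => ha0 (arrayNo_injective h)
        simp [initState, initStore, this, ha0]
    refine .seq ((S.compile_ends hw [] _ s₁ (by simp) h).mono le_rfl fun s₂ h₂ => ?_) le_rfl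
    -- `tmpReg 0` is register `1`, from which the output length is read.
    refine (n.compile_ends hw [] 0 s₂ (by simp) h₂).mono le_rfl ?_
    rintro s₃ ⟨ha₃, hv₃, _⟩
    refine ⟨hv₃, fun j hj => ?_⟩
    rw [ha₃]
    simpa [arrayNo] using h₂.arrs 1 0 hw j hj

end MinRadius

/-! ### The algorithm in the array language, and decoding of its input. -/

namespace MinRadius

/-! ### Derived terms -/

namespace Term

/-- A term holds if its value is not `0`. -/
def Holds (w : ℕ) (μ : Store) (ρ : List ℕ) (t : Term) : Prop := t.eval w μ ρ ≠ 0

/-- The truth value, `0` or `1`, of a term. -/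
def bool (t : Term) : Term := .ite t (.const 1) (.const 0)

def neg (t : Term) : Term := .ite t (.const 0) (.const 1)

def conj (t₁ t₂ : Term) : Term := .ite t₁ t₂ (.const 0)

def disj (t₁ t₂ : Term) : Term := .ite t₁ (.const 1) t₂

def xor (t₁ t₂ : Term) : Term := .ite t₁ t₂.neg t₂

def le (t₁ t₂ : Term) : Term := (Term.sub t₁ t₂).neg

def lt (t₁ t₂ : Term) : Term := .sub t₂ t₁

def eq (t₁ t₂ : Term) : Term := (t₁.le t₂).conj (t₂.le t₁)

/-- The number of values of a variable. -/
def size : Term := .sum (.const 1)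

/-- The entry of the input word whose position is the value of `t`, where `t` is placed below an
additional variable. -/
def inp (t : Term) : Term := .sum (.ite (eq (.var 0) t) (.sum (.get 0 0 1)) (.const 0))

variable {w : ℕ} {μ : Store} {ρ : List ℕ} {t t₁ t₂ t₃ : Term}

open Classical in
theorem eval_bool : t.bool.eval w μ ρ = if t.Holds w μ ρ then 1 else 0 := by
  by_cases h : t.eval w μ ρ = 0 <;> simp [bool, eval, Holds, h]

@[simp] theorem holds_neg : t.neg.Holds w μ ρ ↔ ¬ t.Holds w μ ρ := by
  simp [neg, eval, Holds]

open Classical in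
@[simp] theorem holds_ite : (Term.ite t₁ t₂ t₃).Holds w μ ρ ↔
    if t₁.Holds w μ ρ then t₂.Holds w μ ρ else t₃.Holds w μ ρ := by
  by_cases h : t₁.eval w μ ρ = 0 <;> simp [eval, Holds, h]

@[simp] theorem holds_conj : (t₁.conj t₂).Holds w μ ρ ↔ t₁.Holds w μ ρ ∧ t₂.Holds w μ ρ := by
  by_cases h : t₁.eval w μ ρ = 0 <;> simp [conj, eval, Holds, h]

@[simp] theorem holds_disj : (t₁.disj t₂).Holds w μ ρ ↔ t₁.Holds w μ ρ ∨ t₂.Holds w μ ρ := by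
  by_cases h : t₁.eval w μ ρ = 0 <;> simp [disj, eval, Holds, h]

@[simp] theorem holds_xor : (t₁.xor t₂).Holds w μ ρ ↔ ¬ (t₁.Holds w μ ρ ↔ t₂.Holds w μ ρ) := by
  by_cases h : t₁.eval w μ ρ = 0 <;> simp [xor, neg, eval, Holds, h]

@[simp] theorem holds_le : (t₁.le t₂).Holds w μ ρ ↔ t₁.eval w μ ρ ≤ t₂.eval w μ ρ := by
  rw [le, holds_neg, Holds, eval]
  omega

@[simp] theorem holds_lt : (t₁.lt t₂).Holds w μ ρ ↔ t₁.eval w μ ρ < t₂.eval w μ ρ := by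
  rw [lt, Holds, eval]
  omega

@[simp] theorem holds_eq : (t₁.eq t₂).Holds w μ ρ ↔ t₁.eval w μ ρ = t₂.eval w μ ρ := by
  rw [eq, holds_conj, holds_le, holds_le]
  omega

@[simp] theorem holds_sum : (Term.sum t).Holds w μ ρ ↔ ∃ k < w, t.Holds w μ (k :: ρ) := by
  simp [Holds, eval]

@[simp] theorem holds_get {a i j : ℕ} : (Term.get a i j).Holds w μ ρ ↔
    μ a (ρ.getD i 0) (ρ.getD j 0) ≠ 0 := Iff.rfl

@[simp] theorem eval_size : size.eval w μ ρ = w := by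
  simp [size, eval]

/-- Row `0` of array `0` is the word `g`, and there is nothing else in array `0`. -/
def _root_.MinRadius.HasInput (w : ℕ) (g : ℕ → ℕ) (μ : Store) : Prop :=
  (∀ i j, μ 0 i j = if i = 0 then g j else 0) ∧ ∀ j, w ≤ j → g j = 0

/-- Only variables can serve as indices, so access at a computed position is a sum over all
positions guarded by an equality test. The inner sum runs over the rows, of which only row `0`
contributes. Beyond the word both sides are `0`. -/
theorem eval_inp {g : ℕ → ℕ} (h : HasInput w g μ) (hw : 0 < w) {x : ℕ}
    (ht : ∀ k, t.eval w μ (k :: ρ) = x) : (inp t).eval w μ ρ = g x := by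
  have h1 : ∀ k, (Term.ite (eq (.var 0) t) (.sum (.get 0 0 1)) (.const 0)).eval w μ (k :: ρ) =
      if k = x then g k else 0 := by
    intro k
    have h2 : (Term.sum (.get 0 0 1)).eval w μ (k :: ρ) = g k := by
      simp [eval, h.1, hw]
    rw [eval, h2]
    have h3 : (eq (.var 0) t).eval w μ (k :: ρ) ≠ 0 ↔ k = x := by
      have := holds_eq (w := w) (μ := μ) (ρ := k :: ρ) (t₁ := .var 0) (t₂ := t)
      rw [ht] at this
      exact this
    simp only [h3, eval]
  simp only [inp, eval.eq_def w μ ρ (.sum _), h1]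
  by_cases hx : x < w
  · simp [hx]
  · rw [Finset.sum_eq_zero, h.2 x (by omega)]
    intro k hk
    rw [if_neg]
    rintro rfl
    exact hx (Finset.mem_range.mp hk)

theorem eval_inp_const {g : ℕ → ℕ} (h : HasInput w g μ) (hw : 0 < w) (c : ℕ) :
    (inp (.const c)).eval w μ ρ = g c :=
  eval_inp h hw fun _ => rfl

end Term

/-- The arrays that a statement may change. -/
def Stmt.writes : Stmt → List ℕ
  | .assign a _ => [a]
  | .seq S₁ S₂ => S₁.writes ++ S₂.writes
  | .iter S => S.writes

/-- Frame rule; for the concrete statements its hypothesis is checked by `decide`. -/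
theorem Stmt.exec_of_not_mem_writes {w : ℕ} (S : Stmt) {a : ℕ} (h : a ∉ S.writes) (ρ : List ℕ)
    (μ : Store) : S.exec w ρ μ a = μ a := by
  induction S generalizing ρ μ with
  | assign b t =>
    have : a ≠ b := by simpa [writes] using h
    simp [exec, this]
  | seq S₁ S₂ ih₁ ih₂ =>
    simp only [writes, List.mem_append, not_or] at h
    rw [exec, ih₂ h.2, ih₁ h.1]
  | iter S ih =>
    rw [exec]
    generalize w = N at *
    have : ∀ K, (Nat.rec (motive := fun _ => Store) μ (fun k μ => S.exec N (k :: ρ) μ) K : Store) a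
        = μ a := by
      intro K
      induction K with
      | zero => rfl
      | succ K ihK => exact (ih h _ _).trans ihK
    exact this N

theorem Stmt.exec_iter_induction {w : ℕ} {S : Stmt} {ρ : List ℕ} {μ : Store} (I : ℕ → Store → Prop)
    (h0 : I 0 μ) (step : ∀ k < w, ∀ μ, I k μ → I (k + 1) (S.exec w (k :: ρ) μ)) :
    I w ((Stmt.iter S).exec w ρ μ) := by
  have : ∀ K ≤ w, I K (Nat.rec (motive := fun _ => Store) μ (fun k μ => S.exec w (k :: ρ) μ) K) := by
    intro K
    induction K with
    | zero => exact fun _ => h0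
    | succ K ih => exact fun hK => step K (by omega) _ (ih (by omega))
  exact this w le_rfl

theorem Stmt.exec_assign_self {w : ℕ} {a : ℕ} {t : Term} {ρ : List ℕ} {μ : Store} {i j : ℕ} :
    (Stmt.assign a t).exec w ρ μ a i j = t.eval w μ (j :: i :: ρ) := by
  simp [exec]

/-! ### The algorithm

Array `0` holds the input, `1` the output, `2` the positions of the simplices in the input word, `3`
the incidences of simplices and vertices, `4` the best cycle so far, `5` the pairs of vertices at
distance at most `r`, `6` the boundary matrix, `7` a cycle, and `8` a pivot column.  Vectors are
stored with constant rows and read off the diagonal. -/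

open Term Stmt

/-- The position in the input word of every simplex. -/
def findPositions : Stmt :=
  .seq (.assign 2 (.const 3)) (.iter (.assign 2
    (.ite (eq (.var 1) (.add (.var 2) (.const 1)))
      (.add (.add (.get 2 2 2) (.const 1)) (inp (.get 2 3 3))) (.get 2 1 0))))

/-- The incidences of simplices and vertices. -/
def findIncidences : Stmt :=
  .assign 3 (bool (conj (lt (.var 1) (inp (.const 2)))
    (.sum (conj (lt (.get 2 2 2) (.var 0)) (conj (le (.var 0) (.add (.get 2 2 2) (inp (.get 2 3 3))))
      (eq (inp (.var 1)) (.var 1)))))))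

/-- The given cycle. -/
def readCycle : Stmt :=
  .assign 4 (.ite (lt (.var 1) (inp (.const 2)))
    (inp (.sub (.add size (.var 2)) (inp (.const 2)))) (.const 0))

/-- The number of vertices of a simplex. -/
def cardTerm (i : ℕ) : Term := .sum (.get 3 (i + 1) 0)

/-- Extend the distances, up to the radius `w - 1 - k` where `k` is variable `1`. -/
def growBalls : Stmt :=
  .iter (.assign 5 (.ite (lt (.add (.var 2) (.add (.var 3) (.const 1))) size)
    (disj (.get 5 1 0) (.sum (conj (.get 5 2 0)
      (.sum (conj (eq (cardTerm 0) (.const 2)) (conj (.get 3 0 1) (.get 3 0 2)))))))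
    (.get 5 1 0)))

/-- The pairs of vertices at distance at most `w - 1 - k`, where `k` is variable `0`. -/
def findBalls : Stmt :=
  .seq (.assign 5 (eq (.var 0) (.var 1))) growBalls

/-- The boundary matrix. -/
def boundaryMatrix : Stmt :=
  .assign 6 (conj (eq (cardTerm 1) (.add (inp (.const 1)) (.const 1)))
    (conj (eq (cardTerm 0) (.add (inp (.const 1)) (.const 2)))
      (neg (.sum (conj (.get 3 2 0) (neg (.get 3 1 0)))))))

/-- The first column with a nonzero entry in the given row, if that row belongs to a simplex
outside the ball. -/
def findPivot : Stmt :=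
  .assign 8 (conj (.sum (conj (.get 3 3 0) (neg (.get 5 4 0))))
    (.sum (conj (conj (.get 6 3 0) (neg (.sum (conj (lt (.var 0) (.var 1)) (.get 6 4 0)))))
      (.get 6 2 0))))

/-- Clear a row outside the ball by adding the pivot column. -/
def clearRow : Stmt :=
  .seq findPivot (.seq
    (.assign 7 (xor (.get 7 1 1) (conj (.get 7 2 2) (.get 8 1 1))))
    (.assign 6 (xor (.get 6 1 0) (conj (.get 6 2 0) (.get 8 1 1)))))

/-- Replace the best cycle if the ball contains the reduced one. -/
def updateBest : Stmt :=
  .assign 4 (.ite (conj (lt (.var 2) (inp (.const 0)))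
      (neg (.sum (conj (.sum (conj (.get 3 1 0) (neg (.get 5 4 0)))) (.get 7 0 0)))))
    (.get 7 1 1) (.get 4 1 1))

/-- Try to move the cycle into the ball around a given vertex. -/
def tryBall : Stmt :=
  .seq boundaryMatrix (.seq (.assign 7 (.get 4 1 1)) (.seq (.iter clearRow) updateBest))

/-- Try all balls of a given radius. -/
def tryRadius : Stmt := .seq findBalls (.iter tryBall)

/-- The whole algorithm. -/
def minRadiusStmt : Stmt :=
  .seq findPositions (.seq findIncidences (.seq readCycle (.seq (.iter tryRadius)
    (.assign 1 (bool (.get 4 0 0))))))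

/-! ### Reading the input -/

/-- The position of a simplex in the word `g`. -/
def position (g : ℕ → ℕ) : ℕ → ℕ
  -- The first simplex follows the three header entries `m`, `d` and the number of simplices.
  | 0 => 3
  | i + 1 => position g i + 1 + g (position g i)

/-- Pass `k` computes row `k + 1` from row `k`. Rows are constant, so the entry at `(k, k)` supplies
the previous position. -/
theorem findPositions_spec {w : ℕ} (hw : 0 < w) {g : ℕ → ℕ} {μ : Store} (h : HasInput w g μ) :
    ∀ i ≤ w, ∀ j, findPositions.exec w [] μ 2 i j = position g i := by
  have key : findPositions.exec w [] μ 0 = μ 0 ∧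
      ∀ i ≤ w, ∀ j, findPositions.exec w [] μ 2 i j = position g i := by
    rw [findPositions, exec]
    refine exec_iter_induction (fun k (μ' : Store) => μ' 0 = μ 0 ∧
      ∀ i ≤ k, ∀ j, μ' 2 i j = position g i) ?_ ?_
    · refine ⟨exec_of_not_mem_writes _ (by decide) _ _, ?_⟩
      intro i hi j
      obtain rfl : i = 0 := by omega
      rw [exec_assign_self]
      rfl
    · rintro k hk μ' ⟨h0, h2⟩
      refine ⟨(exec_of_not_mem_writes _ (by decide) _ _).trans h0, ?_⟩
      intro i hi j
      have h' : HasInput w g μ' := by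
        rw [HasInput, h0]
        exact h
      have h1 := eval_inp (ρ := [j, i, k]) (t := .get 2 3 3) h' hw (fun _ => h2 k le_rfl k)
      rw [exec_assign_self, eval]
      have : (eq (.var 1) (.add (.var 2) (.const 1))).eval w μ' (j :: i :: [k]) ≠ 0 ↔ i = k + 1 :=
        holds_eq
      simp only [this]
      by_cases hik : i = k + 1
      · subst hik
        simp [eval, h1, h2 k le_rfl, position]
      · simp [hik, eval, h2 i (by omega)]
  exact key.2

open Classical in
theorem findIncidences_spec {w : ℕ} (hw : 0 < w) {g : ℕ → ℕ} {μ : Store} (h : HasInput w g μ)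
    (hn : g 2 < w) (hpos : ∀ i ≤ w, ∀ j, μ 2 i j = position g i) (i q : ℕ) :
    findIncidences.exec w [] μ 3 i q =
      if i < g 2 ∧ ∃ t < w, position g i < t ∧ t ≤ position g i + g (position g i) ∧ g t = q
      then 1 else 0 := by
  rw [findIncidences, exec_assign_self, eval_bool]
  congr 1
  rw [holds_conj, holds_lt, eval_inp_const h hw, holds_sum]
  simp only [eq_iff_iff]
  refine and_congr_right fun hi => exists_congr fun t => and_congr_right fun ht => ?_
  change i < g 2 at hi
  have hp : ∀ j, μ 2 i j = position g i := hpos i (by omega)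
  have h1 := eval_inp (ρ := [t, q, i]) (t := .get 2 3 3) h hw (fun _ => hp _)
  have h2 := eval_inp (ρ := [t, q, i]) (t := .var 1) h hw (fun _ => rfl)
  rw [holds_conj, holds_conj, holds_lt, holds_le, holds_eq]
  simp [eval, h1, h2, hp]

/-- The coefficients are the last `g 2` entries of the word, hence the position counted from its
end. -/
theorem readCycle_spec {w : ℕ} (hw : 0 < w) {g : ℕ → ℕ} {μ : Store} (h : HasInput w g μ)
    (i j : ℕ) :
    readCycle.exec w [] μ 4 i j = if i < g 2 then g (w + i - g 2) else 0 := by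
  rw [readCycle, exec_assign_self, eval]
  have h1 : (lt (.var 1) (inp (.const 2))).eval w μ (j :: i :: []) ≠ 0 ↔ i < g 2 := by
    refine holds_lt.trans ?_
    rw [eval_inp_const h hw]
    rfl
  rw [eval_inp h hw (x := w + i - g 2)]
  · simp only [h1]
    rfl
  · intro k
    simp [eval, eval_inp_const h hw]

end MinRadius

/-! ### Elimination over `ZMod 2` and the search over all balls. -/

namespace MinRadius

open Term Stmt

/-! ### Column elimination -/

open Classical in
/-- The truth value of a proposition in `ℤ/2`. -/
noncomputable def ind (p : Prop) : ZMod 2 := if p then 1 else 0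

theorem ind_true {p : Prop} (h : p) : ind p = 1 := if_pos h

theorem ind_false {p : Prop} (h : ¬ p) : ind p = 0 := if_neg h

theorem ind_ne_zero {p : Prop} : ind p ≠ 0 ↔ p := by
  by_cases h : p <;> simp [ind, h]

theorem ind_xor (p q : Prop) : ind (¬ (p ↔ q)) = ind p + ind q := by
  by_cases hp : p <;> by_cases hq : q <;> simp [ind, hp, hq]
  decide

theorem ind_and (p q : Prop) : ind (p ∧ q) = ind p * ind q := by
  by_cases hp : p <;> by_cases hq : q <;> simp [ind, hp, hq]

/-- `col'` and `y'` arise from the columns `col` and the vector `y` by adding a pivot column to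
clear the row `k`, if that row is in `O`. -/
def ClearsRow (w : ℕ) (O : ℕ → Prop) (k : ℕ) (col : ℕ → ℕ → ZMod 2) (y : ℕ → ZMod 2)
    (col' : ℕ → ℕ → ZMod 2) (y' : ℕ → ZMod 2) : Prop :=
  ∃ u : ℕ → ZMod 2, (u = 0 ∨ O k ∧ ∃ c < w, u = col c) ∧ (∀ j, col' j = col j + col j k • u) ∧
    y' = y + y k • u ∧ (O k → ∀ j < w, col' j k = 0)

/-- The span of the first `w` columns. -/
def colSpan (w : ℕ) (col : ℕ → ℕ → ZMod 2) : Submodule (ZMod 2) (ℕ → ZMod 2) :=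
  Submodule.span (ZMod 2) (col '' Set.Iio w)

theorem col_mem_colSpan {w : ℕ} {col : ℕ → ℕ → ZMod 2} {j : ℕ} (hj : j < w) :
    col j ∈ colSpan w col :=
  Submodule.subset_span ⟨j, hj, rfl⟩

/-- The linear map that adds the `k`-th entry times `u`. -/
def addMap (k : ℕ) (u : ℕ → ZMod 2) : (ℕ → ZMod 2) →ₗ[ZMod 2] (ℕ → ZMod 2) :=
  LinearMap.id + (LinearMap.proj k).smulRight u

theorem addMap_apply (k : ℕ) (u x : ℕ → ZMod 2) : addMap k u x = x + x k • u := rfl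

/-- The state of the elimination after the rows before `k`. -/
structure Eliminated (w : ℕ) (O : ℕ → Prop) (k : ℕ) (col₀ : ℕ → ℕ → ZMod 2) (y₀ : ℕ → ZMod 2)
    (col : ℕ → ℕ → ZMod 2) (y : ℕ → ZMod 2) : Prop where
  col_mem : ∀ j < w, col j ∈ colSpan w col₀
  sub_mem : y - y₀ ∈ colSpan w col₀
  cleared : ∀ i < k, O i → ∀ j < w, col j i = 0
  target : ∀ v : ℕ → ZMod 2, (∀ i, O i → v i = 0) → v - y₀ ∈ colSpan w col₀ →
    v - y ∈ colSpan w col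

theorem Eliminated.init (w : ℕ) (O : ℕ → Prop) (col₀ : ℕ → ℕ → ZMod 2) (y₀ : ℕ → ZMod 2) :
    Eliminated w O 0 col₀ y₀ col₀ y₀ where
  col_mem _ hj := col_mem_colSpan hj
  sub_mem := by simp
  cleared := by simp
  target _ _ h := h

/-- The whole step is the linear map `addMap k u` applied to the columns and to `y`. It fixes every
vector that vanishes on `O`, so the last invariant is transported along it. -/
theorem Eliminated.step {w k : ℕ} {O : ℕ → Prop} {col₀ col col' : ℕ → ℕ → ZMod 2}
    {y₀ y y' : ℕ → ZMod 2} (h : Eliminated w O k col₀ y₀ col y)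
    (hc : ClearsRow w O k col y col' y') : Eliminated w O (k + 1) col₀ y₀ col' y' := by
  obtain ⟨u, hu, hcol, rfl, hclear⟩ := hc
  have hmem : u ∈ colSpan w col₀ := by
    rcases hu with rfl | ⟨_, c, hc, rfl⟩
    · exact zero_mem _
    · exact h.col_mem c hc
  refine ⟨?_, ?_, ?_, ?_⟩
  · intro j hj
    rw [hcol]
    exact add_mem (h.col_mem j hj) (Submodule.smul_mem _ _ hmem)
  · rw [add_sub_right_comm]
    exact add_mem h.sub_mem (Submodule.smul_mem _ _ hmem)
  · intro i hi hO j hj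
    rcases Nat.lt_succ_iff_lt_or_eq.mp hi with hi | rfl
    · rw [hcol]
      -- Rows cleared earlier stay clear, because the pivot is itself a current column.
      have hui : u i = 0 := by
        rcases hu with rfl | ⟨_, c, hc, rfl⟩
        · rfl
        · exact h.cleared i hi hO c hc
      simp [hui, h.cleared i hi hO j hj]
    · exact hclear hO j hj
  · intro v hv hvm
    have h1 := Submodule.mem_map_of_mem (f := addMap k u) (h.target v hv hvm)
    rw [colSpan, Submodule.map_span, ← Set.image_comp] at h1
    have h2 : (addMap k u ∘ col) = col' := by
      funext j
      simp [addMap_apply, hcol]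
    rw [h2, map_sub, addMap_apply, addMap_apply] at h1
    -- Either there is no pivot, or row `k` lies in `O`, where `v` vanishes.
    have h3 : v + v k • u = v := by
      rcases hu with rfl | ⟨hO, _⟩
      · simp
      · simp [hv k hO]
    rw [h3] at h1
    exact h1

/-- The difference `v - y` is a combination of columns that vanish on the rows of `O` below `w`. So
the mere existence of a solution `v` forces `y` to be a solution there. -/
theorem Eliminated.apply_eq_zero {w : ℕ} {O : ℕ → Prop} {col₀ col : ℕ → ℕ → ZMod 2}
    {y₀ y v : ℕ → ZMod 2} (h : Eliminated w O w col₀ y₀ col y) (hv : ∀ i, O i → v i = 0)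
    (hvm : v - y₀ ∈ colSpan w col₀) {i : ℕ} (hi : i < w) (hO : O i) : y i = 0 := by
  have h1 : colSpan w col ≤ LinearMap.ker (LinearMap.proj (R := ZMod 2) (φ := fun _ => ZMod 2) i) := by
    refine Submodule.span_le.mpr ?_
    rintro _ ⟨j, hj, rfl⟩
    exact h.cleared i hi hO j hj
  have h2 := h1 (h.target v hv hvm)
  rw [LinearMap.mem_ker, LinearMap.proj_apply, Pi.sub_apply, hv i hO, zero_sub, neg_eq_zero] at h2
  exact h2

/-! ### The effect of the algorithm on a list of faces -/

/-- The vertices that can be reached from `p` along at most `r` edges. -/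
def Reach (w : ℕ) (face : ℕ → Finset ℕ) : ℕ → ℕ → ℕ → Prop
  | 0, p, q => q = p
  | r + 1, p, q => Reach w face r p q ∨
      ∃ u < w, Reach w face r p u ∧ ∃ i < w, (face i).card = 2 ∧ u ∈ face i ∧ q ∈ face i

/-- The face `i` is not contained in the ball of radius `r` around `p`. -/
def Outside (w : ℕ) (face : ℕ → Finset ℕ) (r p i : ℕ) : Prop :=
  ∃ q < w, q ∈ face i ∧ ¬ Reach w face r p q

/-- The columns of the boundary matrix. -/
noncomputable def boundaryCol (face : ℕ → Finset ℕ) (d j i : ℕ) : ZMod 2 :=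
  ind ((face i).card = d + 1 ∧ (face j).card = d + 2 ∧ face i ⊆ face j)

/-- The vector on the diagonal of array `a`. -/
noncomputable def diag (μ : Store) (a i : ℕ) : ZMod 2 := ind (μ a i i ≠ 0)

/-- The columns of array `a`. -/
noncomputable def column (μ : Store) (a j i : ℕ) : ZMod 2 := ind (μ a i j ≠ 0)

/-- The store contains the input word `g` and the incidence matrix of the faces. -/
structure HasFaces (w : ℕ) (g : ℕ → ℕ) (face : ℕ → Finset ℕ) (μ : Store) : Prop where
  pos : 0 < w
  input : HasInput w g μ
  vertex_lt : ∀ i, ∀ q ∈ face i, q < w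
  face_eq_empty : ∀ i, w ≤ i → face i = ∅
  incidence : ∀ i q, μ 3 i q = if q ∈ face i then 1 else 0

section

variable {w : ℕ} {g : ℕ → ℕ} {face : ℕ → Finset ℕ} {μ μ' : Store}

theorem HasFaces.congr (h : HasFaces w g face μ) (h0 : μ' 0 = μ 0) (h3 : μ' 3 = μ 3) :
    HasFaces w g face μ' where
  pos := h.pos
  input := by
    rw [HasInput, h0]
    exact h.input
  vertex_lt := h.vertex_lt
  face_eq_empty := h.face_eq_empty
  incidence := by
    rw [h3]
    exact h.incidence

theorem HasFaces.exec (h : HasFaces w g face μ) {S : Stmt} (h0 : 0 ∉ S.writes) (h3 : 3 ∉ S.writes)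
    (ρ : List ℕ) : HasFaces w g face (S.exec w ρ μ) :=
  h.congr (S.exec_of_not_mem_writes h0 ρ μ) (S.exec_of_not_mem_writes h3 ρ μ)

theorem HasFaces.incidence_ne_zero (h : HasFaces w g face μ) (i q : ℕ) :
    μ 3 i q ≠ 0 ↔ q ∈ face i := by
  rw [h.incidence]
  split_ifs <;> simp [*]

theorem HasFaces.eval_cardTerm (h : HasFaces w g face μ) (ρ : List ℕ) (i : ℕ) :
    (cardTerm i).eval w μ ρ = (face (ρ.getD i 0)).card := by
  simp only [cardTerm, eval, List.getD_cons_succ, List.getD_cons_zero, h.incidence]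
  rw [Finset.sum_ite_mem, Finset.sum_const, smul_eq_mul, mul_one, Finset.inter_eq_right.mpr]
  exact fun q hq => Finset.mem_range.mpr (h.vertex_lt _ q hq)

/-- One edge is added per pass as long as `l + 1 + k < w`, so after `l` passes the radius is `min l
(w - 1 - k)`. -/
theorem findBalls_spec (h : HasFaces w g face μ) {k : ℕ} (hk : k < w) (p q : ℕ) :
    findBalls.exec w [k] μ 5 p q ≠ 0 ↔ Reach w face (w - 1 - k) p q := by
  have key : HasFaces w g face (findBalls.exec w [k] μ) ∧
      ∀ p q, findBalls.exec w [k] μ 5 p q ≠ 0 ↔ Reach w face (min w (w - 1 - k)) p q := by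
    rw [findBalls, Stmt.exec, growBalls]
    refine exec_iter_induction (fun l μ => HasFaces w g face μ ∧
      ∀ p q, μ 5 p q ≠ 0 ↔ Reach w face (min l (w - 1 - k)) p q) ?_ ?_
    · refine ⟨h.exec (by decide) (by decide) _, fun p q => ?_⟩
      rw [exec_assign_self, Nat.zero_min]
      exact holds_eq
    · rintro l hl μ ⟨h, h5⟩
      refine ⟨h.exec (by decide) (by decide) _, fun p q => ?_⟩
      rw [exec_assign_self]
      refine holds_ite.trans ?_
      rw [holds_lt, eval_size, holds_disj, holds_sum]
      simp only [holds_conj, holds_sum, holds_eq, h.eval_cardTerm, holds_get, h.incidence_ne_zero, h5,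
        eval, List.getD_cons_succ, List.getD_cons_zero]
      by_cases hlk : l + 1 + k < w
      · rw [if_pos (by simpa using by omega), min_eq_left (by omega), min_eq_left (by omega)]
        rfl
      · rw [if_neg (by simpa using by omega), min_eq_right (by omega), min_eq_right (by omega)]
  rw [key.2, min_eq_right (by omega)]

theorem boundaryMatrix_spec (h : HasFaces w g face μ) (ρ : List ℕ) :
    column (boundaryMatrix.exec w ρ μ) 6 = boundaryCol face (g 1) := by
  funext j i
  rw [column, boundaryCol, boundaryMatrix, exec_assign_self]
  congr 1
  refine propext (holds_conj.trans ?_)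
  rw [holds_conj, holds_eq, holds_eq, h.eval_cardTerm, h.eval_cardTerm, holds_neg, holds_sum]
  simp only [holds_conj, holds_neg, holds_get, h.incidence_ne_zero, eval,
    eval_inp_const h.input h.pos, List.getD_cons_succ, List.getD_cons_zero]
  refine and_congr_right fun _ => and_congr_right fun _ => ?_
  constructor
  · intro hn q hq
    by_contra hq'
    exact hn ⟨q, h.vertex_lt _ _ hq, hq, hq'⟩
  · rintro hs ⟨q, _, hq, hq'⟩
    exact hq' (hs hq)

theorem exists_outside_iff (h : HasFaces w g face μ) {r p i : ℕ}
    (hR : ∀ p q, μ 5 p q ≠ 0 ↔ Reach w face r p q) :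
    (∃ q < w, μ 3 i q ≠ 0 ∧ ¬ μ 5 p q ≠ 0) ↔ Outside w face r p i := by
  simp only [hR, h.incidence_ne_zero]
  rfl

/-- The pivot is the first column meeting row `k`; uniqueness of the first one makes the sum in
`findPivot` select a single column. Without such a column, or for a row inside the ball, the pivot
vector is `0`. -/
theorem clearRow_spec (h : HasFaces w g face μ) {r k p l : ℕ}
    (hR : ∀ p q, μ 5 p q ≠ 0 ↔ Reach w face r p q) :
    ClearsRow w (Outside w face r p) k (column μ 6) (diag μ 7)
      (column (clearRow.exec w [k, p, l] μ) 6) (diag (clearRow.exec w [k, p, l] μ) 7) := by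
  set μ₁ := findPivot.exec w [k, p, l] μ with hμ₁
  have hpivot : ∀ i, μ₁ 8 i i ≠ 0 ↔ Outside w face r p k ∧
      ∃ c < w, (μ 6 k c ≠ 0 ∧ ¬ ∃ c' < w, c' < c ∧ μ 6 k c' ≠ 0) ∧ μ 6 i c ≠ 0 := by
    intro i
    rw [hμ₁, findPivot, exec_assign_self]
    refine holds_conj.trans ?_
    rw [holds_sum, holds_sum]
    simp only [holds_conj, holds_neg, holds_sum, holds_lt, holds_get, eval, List.getD_cons_succ,
      List.getD_cons_zero]
    refine and_congr ?_ Iff.rfl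
    exact exists_outside_iff h hR
  have h7 : μ₁ 7 = μ 7 := exec_of_not_mem_writes _ (by decide) _ _
  have h6 : μ₁ 6 = μ 6 := exec_of_not_mem_writes _ (by decide) _ _
  set μ₂ := (Stmt.assign 7 (xor (.get 7 1 1) (conj (.get 7 2 2) (.get 8 1 1)))).exec w [k, p, l] μ₁
    with hμ₂
  have h8' : μ₂ 8 = μ₁ 8 := exec_of_not_mem_writes _ (by decide) _ _
  have h6' : μ₂ 6 = μ 6 := (exec_of_not_mem_writes _ (by decide) _ _).trans h6
  have hexec : clearRow.exec w [k, p, l] μ =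
      (Stmt.assign 6 (xor (.get 6 1 0) (conj (.get 6 2 0) (.get 8 1 1)))).exec w [k, p, l] μ₂ := rfl
  have hcol : ∀ j, column (clearRow.exec w [k, p, l] μ) 6 j =
      column μ 6 j + column μ 6 j k • diag μ₁ 8 := by
    intro j
    funext i
    rw [Pi.add_apply, Pi.smul_apply, smul_eq_mul, column, column, column, diag, ← ind_and, ← ind_xor,
      hexec, exec_assign_self]
    congr 1
    refine propext (holds_xor.trans ?_)
    rw [holds_conj]
    simp only [holds_get, List.getD_cons_succ, List.getD_cons_zero, h6', h8']
  refine ⟨diag μ₁ 8, ?_, hcol, ?_, ?_⟩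
  · by_cases hO : Outside w face r p k
    · by_cases hc : ∃ c < w, μ 6 k c ≠ 0
      · refine Or.inr ⟨hO, ?_⟩
        classical
        refine ⟨Nat.find hc, (Nat.find_spec hc).1, ?_⟩
        funext i
        rw [diag, column]
        congr 1
        refine propext ((hpivot i).trans ?_)
        constructor
        · rintro ⟨_, c, hcw, ⟨hkc, hmin⟩, hic⟩
          have : Nat.find hc = c := by
            refine (Nat.find_eq_iff hc).mpr ⟨⟨hcw, hkc⟩, ?_⟩
            rintro c' hc' ⟨hcw', hkc'⟩
            exact hmin ⟨c', hcw', hc', hkc'⟩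
          rwa [this]
        · intro hic
          refine ⟨hO, _, (Nat.find_spec hc).1, ⟨(Nat.find_spec hc).2, ?_⟩, hic⟩
          rintro ⟨c', hcw', hc', hkc'⟩
          exact Nat.find_min hc hc' ⟨hcw', hkc'⟩
      · left
        funext i
        refine ind_false fun hi => hc ?_
        obtain ⟨_, c, hcw, ⟨hkc, _⟩, _⟩ := (hpivot i).mp hi
        exact ⟨c, hcw, hkc⟩
    · left
      funext i
      exact ind_false fun hi => hO ((hpivot i).mp hi).1
  · funext i
    have h7' : (clearRow.exec w [k, p, l] μ) 7 = μ₂ 7 := by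
      rw [hexec]
      exact exec_of_not_mem_writes _ (by decide) _ _
    rw [Pi.add_apply, Pi.smul_apply, smul_eq_mul, diag, diag, diag, diag, ← ind_and, ← ind_xor, h7',
      hμ₂, exec_assign_self]
    congr 1
    refine propext (holds_xor.trans ?_)
    rw [holds_conj]
    simp only [holds_get, List.getD_cons_succ, List.getD_cons_zero, h7]
  · intro hO j hj
    rw [hcol, Pi.add_apply, Pi.smul_apply, smul_eq_mul]
    by_cases hkj : μ 6 k j ≠ 0
    · have h8 : μ₁ 8 k k ≠ 0 := by
        classical
        have hc : ∃ c < w, μ 6 k c ≠ 0 := ⟨j, hj, hkj⟩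
        refine (hpivot k).mpr ⟨hO, _, (Nat.find_spec hc).1, ⟨(Nat.find_spec hc).2, ?_⟩,
          (Nat.find_spec hc).2⟩
        rintro ⟨c', hcw', hc', hkc'⟩
        exact Nat.find_min hc hc' ⟨hcw', hkc'⟩
      rw [column, diag, ind_true hkj, ind_true h8]
      -- `1 + 1 * 1 = 0` in `ZMod 2`; in particular the pivot column cancels itself.
      decide
    · rw [column, ind_false hkj, zero_mul, zero_add]

/-- A vector is supported on the ball of radius `r` around `p`. -/
def Inside (w : ℕ) (face : ℕ → Finset ℕ) (r p : ℕ) (v : ℕ → ZMod 2) : Prop :=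
  ∀ i, Outside w face r p i → v i = 0

theorem Outside.lt (h : HasFaces w g face μ) {r p i : ℕ} (hO : Outside w face r p i) : i < w := by
  by_contra hi
  obtain ⟨q, _, hq, _⟩ := hO
  simp [h.face_eq_empty i (by omega)] at hq

/-- The effect of trying one ball: the cycle is replaced by a homologous one, and by one supported
on the ball if there is one; otherwise it is kept. -/
theorem tryBall_spec (h : HasFaces w g face μ) {r p l : ℕ}
    (hR : ∀ p q, μ 5 p q ≠ 0 ↔ Reach w face r p q) :
    (tryBall.exec w [p, l] μ) 5 = μ 5 ∧
    HasFaces w g face (tryBall.exec w [p, l] μ) ∧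
    diag (tryBall.exec w [p, l] μ) 4 - diag μ 4 ∈ colSpan w (boundaryCol face (g 1)) ∧
    (diag (tryBall.exec w [p, l] μ) 4 = diag μ 4 ∨
      p < g 0 ∧ Inside w face r p (diag (tryBall.exec w [p, l] μ) 4)) ∧
    (p < g 0 → (∃ v, v - diag μ 4 ∈ colSpan w (boundaryCol face (g 1)) ∧ Inside w face r p v) →
      Inside w face r p (diag (tryBall.exec w [p, l] μ) 4)) := by
  set μ₁ := boundaryMatrix.exec w [p, l] μ with hμ₁
  have h6₁ : column μ₁ 6 = boundaryCol face (g 1) := boundaryMatrix_spec h _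
  have h1 : HasFaces w g face μ₁ := h.exec (by decide) (by decide) _
  have h5₁ : μ₁ 5 = μ 5 := exec_of_not_mem_writes _ (by decide) _ _
  have h4₁ : μ₁ 4 = μ 4 := exec_of_not_mem_writes _ (by decide) _ _
  set μ₂ := (Stmt.assign 7 (.get 4 1 1)).exec w [p, l] μ₁ with hμ₂
  have h6₂ : column μ₂ 6 = boundaryCol face (g 1) := h6₁
  have h7₂ : diag μ₂ 7 = diag μ 4 := by
    funext i
    rw [diag, hμ₂, exec_assign_self, eval, h4₁]
    rfl
  set μ₃ := (Stmt.iter clearRow).exec w [p, l] μ₂ with hμ₃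
  have h3 : HasFaces w g face μ₃ :=
    (h1.exec (by decide) (by decide) _).exec (by decide) (by decide) _
  have h5₃ : μ₃ 5 = μ 5 := by
    rw [hμ₃, exec_of_not_mem_writes _ (by decide), hμ₂, exec_of_not_mem_writes _ (by decide), h5₁]
  have h4₃ : μ₃ 4 = μ 4 := by
    rw [hμ₃, exec_of_not_mem_writes _ (by decide), hμ₂, exec_of_not_mem_writes _ (by decide), h4₁]
  have helim : HasFaces w g face μ₃ ∧ μ₃ 5 = μ 5 ∧
      Eliminated w (Outside w face r p) w (boundaryCol face (g 1)) (diag μ 4)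
        (column μ₃ 6) (diag μ₃ 7) := by
    refine exec_iter_induction (fun k μ' => HasFaces w g face μ' ∧ μ' 5 = μ 5 ∧
      Eliminated w (Outside w face r p) k (boundaryCol face (g 1)) (diag μ 4)
        (column μ' 6) (diag μ' 7)) ?_ ?_
    · refine ⟨h1.exec (by decide) (by decide) _, ?_, ?_⟩
      · rw [hμ₂, exec_of_not_mem_writes _ (by decide), h5₁]
      · rw [h6₂, h7₂]
        exact Eliminated.init _ _ _ _
    · rintro k hk μ' ⟨h', h5', he⟩
      refine ⟨h'.exec (by decide) (by decide) _, ?_, he.step (clearRow_spec h' ?_)⟩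
      · rw [exec_of_not_mem_writes _ (by decide), h5']
      · rw [h5']
        exact hR
  obtain ⟨_, _, helim⟩ := helim
  classical
  have hexec : tryBall.exec w [p, l] μ = updateBest.exec w [p, l] μ₃ := rfl
  have hupdate : ∀ i, updateBest.exec w [p, l] μ₃ 4 i i ≠ 0 ↔
      if p < g 0 ∧ Inside w face r p (diag μ₃ 7) then μ₃ 7 i i ≠ 0 else μ 4 i i ≠ 0 := by
    intro i
    rw [updateBest, exec_assign_self]
    refine holds_ite.trans ?_
    rw [holds_conj, holds_lt, eval_inp_const h3.input h3.pos, holds_neg, holds_sum]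
    simp only [holds_conj, holds_neg, holds_sum, holds_get, eval, List.getD_cons_succ,
      List.getD_cons_zero, h4₃]
    have hcond : (¬ ∃ k < w, (∃ q < w, μ₃ 3 k q ≠ 0 ∧ ¬ μ₃ 5 p q ≠ 0) ∧ μ₃ 7 k k ≠ 0) ↔
        Inside w face r p (diag μ₃ 7) := by
      have hout : ∀ k, (∃ q < w, μ₃ 3 k q ≠ 0 ∧ ¬ μ₃ 5 p q ≠ 0) ↔ Outside w face r p k :=
        fun k => exists_outside_iff h3 (by rw [h5₃]; exact hR)
      simp only [hout]
      constructor
      · intro hn k hk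
        exact ind_false fun hk' => hn ⟨k, hk.lt h, hk, hk'⟩
      · rintro hi ⟨k, _, hk, hk'⟩
        exact ind_ne_zero.mpr hk' (hi k hk)
    simp only [hcond]
  have hdiag : diag (tryBall.exec w [p, l] μ) 4 =
      if p < g 0 ∧ Inside w face r p (diag μ₃ 7) then diag μ₃ 7 else diag μ 4 := by
    funext i
    rw [diag, hexec, propext (hupdate i)]
    split_ifs <;> rfl
  refine ⟨?_, h3.exec (by decide) (by decide) _, ?_, ?_, ?_⟩
  · rw [hexec, exec_of_not_mem_writes _ (by decide), h5₃]
  · rw [hdiag]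
    split_ifs
    · exact helim.sub_mem
    · simp
  · rw [hdiag]
    split_ifs with hc
    · exact Or.inr hc
    · exact Or.inl rfl
  · rintro hp ⟨v, hvm, hv⟩
    -- Only rows below `w` were cleared, but no index from `w` on is outside the ball, its face
    -- being empty.
    have hin : Inside w face r p (diag μ₃ 7) :=
      fun i hi => helim.apply_eq_zero hv hvm (hi.lt h) hi
    rw [hdiag, if_pos ⟨hp, hin⟩]
    exact hin

/-- Some vector equivalent to `v₀` is supported on the ball of radius `r` around `p`. -/
def Feasible (w : ℕ) (g : ℕ → ℕ) (face : ℕ → Finset ℕ) (v₀ : ℕ → ZMod 2) (r p : ℕ) : Prop :=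
  ∃ v, v - v₀ ∈ colSpan w (boundaryCol face (g 1)) ∧ Inside w face r p v

/-- The vector is supported on a ball of radius at most `r`. -/
def Fits (w : ℕ) (g : ℕ → ℕ) (face : ℕ → Finset ℕ) (r : ℕ) (v : ℕ → ZMod 2) : Prop :=
  ∃ r' ≤ r, ∃ p < g 0, Inside w face r' p v

/-- Pass `l` treats radius `w - 1 - l`. A replacement made now fits a ball of this smaller radius,
hence keeps the guarantees already obtained for larger radii. -/
theorem tryRadius_spec (h : HasFaces w g face μ) {v₀ : ℕ → ZMod 2} {l : ℕ} (hl : l < w)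
    (hg : g 0 ≤ w) (hv : diag μ 4 - v₀ ∈ colSpan w (boundaryCol face (g 1)))
    (hfit : ∀ r < w, w - l ≤ r → (∃ p < g 0, Feasible w g face v₀ r p) →
      Fits w g face r (diag μ 4)) :
    HasFaces w g face (tryRadius.exec w [l] μ) ∧
    diag (tryRadius.exec w [l] μ) 4 - v₀ ∈ colSpan w (boundaryCol face (g 1)) ∧
    ∀ r < w, w - (l + 1) ≤ r → (∃ p < g 0, Feasible w g face v₀ r p) →
      Fits w g face r (diag (tryRadius.exec w [l] μ) 4) := by
  have key := exec_iter_induction (w := w) (S := tryBall) (ρ := [l]) (μ := findBalls.exec w [l] μ)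
    (fun k μ => HasFaces w g face μ ∧ (∀ p q, μ 5 p q ≠ 0 ↔ Reach w face (w - 1 - l) p q) ∧
      diag μ 4 - v₀ ∈ colSpan w (boundaryCol face (g 1)) ∧
      (∀ r < w, w - l ≤ r → (∃ p < g 0, Feasible w g face v₀ r p) → Fits w g face r (diag μ 4)) ∧
      ((∃ p < g 0, p < k ∧ Feasible w g face v₀ (w - 1 - l) p) →
        Fits w g face (w - 1 - l) (diag μ 4))) ?_ ?_
  · obtain ⟨h', _, hv', hfit', hl'⟩ := key
    refine ⟨h', hv', fun r hr hrl hp => ?_⟩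
    rcases Nat.lt_or_ge r (w - l) with hr' | hr'
    · obtain rfl : r = w - 1 - l := by omega
      obtain ⟨p, hp, hf⟩ := hp
      exact hl' ⟨p, hp, by omega, hf⟩
    · exact hfit' r hr hr' hp
  · have h4 : diag (findBalls.exec w [l] μ) 4 = diag μ 4 := by
      funext i
      rw [diag, exec_of_not_mem_writes _ (by decide)]
      rfl
    refine ⟨h.exec (by decide) (by decide) _, findBalls_spec h hl, ?_, ?_, ?_⟩
    · rwa [h4]
    · rwa [h4]
    · rintro ⟨p, _, hp, _⟩
      omega
  · rintro k hk μ ⟨h, hR, hv, hfit, hl'⟩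
    obtain ⟨h5, h', hsub, hor, hin⟩ := tryBall_spec h (p := k) (l := l) hR
    refine ⟨h', by rwa [h5], ?_, ?_, ?_⟩
    · simpa using add_mem hsub hv
    · intro r hr hrl hp
      rcases hor with heq | ⟨hk', hi⟩
      · rw [heq]
        exact hfit r hr hrl hp
      · exact ⟨_, by omega, k, hk', hi⟩
    · rintro ⟨p, hp, hpk, v, hvm, hvi⟩
      rcases Nat.lt_succ_iff_lt_or_eq.mp hpk with hpk | rfl
      · rcases hor with heq | ⟨hk', hi⟩
        · rw [heq]
          exact hl' ⟨p, hp, hpk, v, hvm, hvi⟩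
        · exact ⟨_, le_rfl, k, hk', hi⟩
      -- Feasibility refers to `v₀`, the trial to the current cycle; the two differ by an element of
      -- the column span.
      · refine ⟨_, le_rfl, p, hp, hin hp ⟨v, ?_, hvi⟩⟩
        simpa using sub_mem hvm hv

theorem iter_tryRadius_spec (h : HasFaces w g face μ) (hg : g 0 ≤ w) :
    diag ((Stmt.iter tryRadius).exec w [] μ) 4 - diag μ 4 ∈ colSpan w (boundaryCol face (g 1)) ∧
    ∀ r < w, (∃ p < g 0, Feasible w g face (diag μ 4) r p) →
      Fits w g face r (diag ((Stmt.iter tryRadius).exec w [] μ) 4) := by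
  have key := exec_iter_induction (w := w) (S := tryRadius) (ρ := []) (μ := μ)
    (fun l μ' => HasFaces w g face μ' ∧
      diag μ' 4 - diag μ 4 ∈ colSpan w (boundaryCol face (g 1)) ∧
      ∀ r < w, w - l ≤ r → (∃ p < g 0, Feasible w g face (diag μ 4) r p) →
        Fits w g face r (diag μ' 4)) ?_ ?_
  · exact ⟨key.2.1, fun r hr => key.2.2 r hr (by omega)⟩
  · refine ⟨h, by simp, fun r hr hr' => by omega⟩
  · rintro l hl μ' ⟨h', hv, hfit⟩
    exact tryRadius_spec h' hl hg hv hfit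

end

end MinRadius

/-! ### Homology, distances and radii in terms of the vectors of the algorithm. -/

namespace MinRadius

variable {m : ℕ} {K : AbstractSimplicialComplex (Fin m)}

/-! ### Boundaries are cycles -/

theorem nonempty_of_mem {σ : Finset (Fin m)} (h : σ ∈ K) : σ.Nonempty :=
  (K.isRelLowerSet_faces h).1

theorem mem_of_subset {σ τ : Finset (Fin m)} (h : σ ∈ K) (hτ : τ ⊆ σ) (hne : τ.Nonempty) : τ ∈ K :=
  (K.isRelLowerSet_faces h).2 hτ hne

/-- The simplices strictly between `τ` and `ρ` come in pairs: `ρ` has two vertices outside `τ`, and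
`σ ↦ τ ∪ (ρ \ σ)` exchanges the one that is added. -/
theorem card_between {d : ℕ} (τ : Simplex K d) (ρ : Simplex K (d + 2)) :
    ∑ σ : Simplex K (d + 1), (if τ.1 ⊆ σ.1 ∧ σ.1 ⊆ ρ.1 then 1 else 0 : ZMod 2) = 0 := by
  rw [← Finset.sum_filter]
  have hcard : ∀ σ : Simplex K (d + 1), σ.1 ⊆ ρ.1 → (ρ.1 \ σ.1).card = 1 := by
    intro σ h
    rw [Finset.card_sdiff_of_subset h, ρ.2.2, σ.2.2]
    omega
  have hother : ∀ σ : Simplex K (d + 1), τ.1 ⊆ σ.1 ∧ σ.1 ⊆ ρ.1 →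
      τ.1 ∪ (ρ.1 \ σ.1) ∈ K ∧ (τ.1 ∪ (ρ.1 \ σ.1)).card = d + 1 := by
    rintro σ ⟨h1, h2⟩
    have hc : (τ.1 ∪ (ρ.1 \ σ.1)).card = d + 1 := by
      rw [Finset.card_union_of_disjoint, hcard σ h2, τ.2.2]
      exact Finset.disjoint_of_subset_left h1 Finset.disjoint_sdiff
    refine ⟨mem_of_subset ρ.2.1 (Finset.union_subset (h1.trans h2) Finset.sdiff_subset) ?_, hc⟩
    rw [← Finset.card_pos]
    omega
  refine Finset.sum_involution
    (fun σ h => ⟨τ.1 ∪ (ρ.1 \ σ.1), hother σ (Finset.mem_filter.mp h).2⟩) ?_ ?_ ?_ ?_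
  · intro σ _
    decide
  -- A fixed point would give `ρ \ σ ⊆ σ`, so the one-element set `ρ \ σ` would be empty.
  · intro σ h _ heq
    have h2 := (Finset.mem_filter.mp h).2.2
    have h3 : ρ.1 \ σ.1 ⊆ σ.1 := by
      have := congrArg Subtype.val heq
      exact Finset.subset_union_right.trans this.subset
    have h4 : ρ.1 \ σ.1 = ∅ := by
      rw [← Finset.disjoint_self_iff_empty]
      exact Finset.disjoint_of_subset_right h3 Finset.sdiff_disjoint
    have := hcard σ h2
    rw [h4] at this
    simp at this
  · intro σ h
    obtain ⟨h1, h2⟩ := (Finset.mem_filter.mp h).2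
    exact Finset.mem_filter.mpr ⟨Finset.mem_univ _, Finset.subset_union_left,
      Finset.union_subset (h1.trans h2) Finset.sdiff_subset⟩
  · intro σ h
    obtain ⟨h1, h2⟩ := (Finset.mem_filter.mp h).2
    apply Subtype.ext
    ext x
    have h1x := @h1 x
    have h2x := @h2 x
    simp only [Finset.mem_union, Finset.mem_sdiff]
    tauto

theorem boundaries_le_cycles (K : AbstractSimplicialComplex (Fin m)) (d : ℕ) :
    boundaries K d ≤ cycles K d := by
  rintro _ ⟨c, rfl⟩
  rw [cycles, LinearMap.mem_ker]
  funext τ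
  change ∑ σ : Simplex K (d + 1), (if τ.1 ⊆ σ.1 then
    ∑ ρ : Simplex K (d + 1 + 1), (if σ.1 ⊆ ρ.1 then c ρ else 0) else 0) = 0
  have h1 : ∀ σ : Simplex K (d + 1), (if τ.1 ⊆ σ.1 then
      ∑ ρ : Simplex K (d + 1 + 1), (if σ.1 ⊆ ρ.1 then c ρ else 0) else 0) =
      ∑ ρ : Simplex K (d + 1 + 1), (if τ.1 ⊆ σ.1 ∧ σ.1 ⊆ ρ.1 then 1 else 0) * c ρ := by
    intro σ
    by_cases h : τ.1 ⊆ σ.1 <;> simp [h]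
  rw [Finset.sum_congr rfl fun σ _ => h1 σ, Finset.sum_comm]
  refine Finset.sum_eq_zero fun ρ _ => ?_
  rw [← Finset.sum_mul, card_between, zero_mul]

theorem homologyClass_eq_iff {d : ℕ} (z z' : cycles K d) :
    homologyClass K d z = homologyClass K d z' ↔ (z : Chain K d) - z' ∈ boundaries K d := by
  rw [homologyClass, homologyClass, Submodule.Quotient.eq]
  rfl

/-! ### Chains as vectors -/

/-- The `i`-th simplex of the list as a set of natural numbers. -/
def face (L : List (Finset (Fin m))) (i : ℕ) : Finset ℕ :=
  (L.getD i ∅).map Fin.valEmbedding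

theorem mem_face {L : List (Finset (Fin m))} {i q : ℕ} :
    q ∈ face L i ↔ ∃ h : q < m, ⟨q, h⟩ ∈ L.getD i ∅ := by
  rw [face, Finset.mem_map]
  constructor
  · rintro ⟨x, hx, rfl⟩
    exact ⟨x.2, hx⟩
  · rintro ⟨h, hx⟩
    exact ⟨_, hx, rfl⟩

theorem card_face (L : List (Finset (Fin m))) (i : ℕ) : (face L i).card = (L.getD i ∅).card :=
  Finset.card_map _

section

variable {L : List (Finset (Fin m))}

theorem Enumerates.getD_mem (hL : Enumerates L K) {i : ℕ} (hi : i < L.length) : L.getD i ∅ ∈ K := by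
  rw [List.getD_eq_getElem _ _ hi]
  exact (hL.2 _).mp (List.getElem_mem hi)

/-- The default `∅` has no vertices, so positive cardinality forces the index into range. -/
theorem Enumerates.getD_mem_of_card (hL : Enumerates L K) {i k : ℕ}
    (h : (L.getD i ∅).card = k + 1) : L.getD i ∅ ∈ K := by
  refine hL.getD_mem ?_
  by_contra hi
  rw [List.getD_eq_default _ _ (by omega)] at h
  simp at h

theorem Enumerates.exists_getD_eq (hL : Enumerates L K) {σ : Finset (Fin m)} (h : σ ∈ K) :
    ∃ i < L.length, L.getD i ∅ = σ := by
  obtain ⟨i, hi, rfl⟩ := List.mem_iff_getElem.mp ((hL.2 σ).mpr h)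
  exact ⟨i, hi, List.getD_eq_getElem _ _ hi⟩

/-- Every vertex is itself a simplex. This is what allows bounds in terms of the number of simplices
alone. -/
theorem Enumerates.card_le (hL : Enumerates L K) : m ≤ L.length := by
  rw [← List.toFinset_card_of_nodup hL.1]
  have h := Finset.card_le_card_of_injOn (s := Finset.univ) (t := L.toFinset)
    (fun p : Fin m => ({p} : Finset (Fin m))) ?_ ?_
  · simpa using h
  · intro p _
    simpa using (hL.2 {p}).mpr (K.singleton_mem p)
  · intro p _ q _ h
    simpa using h

variable (L)

open Classical in
/-- The coefficients of a chain at the simplices of a list. -/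
noncomputable def chainVec (d : ℕ) : Chain K d →ₗ[ZMod 2] (ℕ → ZMod 2) where
  toFun c i := if h : L.getD i ∅ ∈ K ∧ (L.getD i ∅).card = d + 1 then c ⟨L.getD i ∅, h⟩ else 0
  map_add' c c' := by
    funext i
    by_cases h : L.getD i ∅ ∈ K ∧ (L.getD i ∅).card = d + 1 <;>
      simp only [h, Pi.add_apply, dite_false, add_zero]
    rfl
  map_smul' a c := by
    funext i
    by_cases h : L.getD i ∅ ∈ K ∧ (L.getD i ∅).card = d + 1
    · simp only [h, Pi.smul_apply, RingHom.id_apply]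
      rfl
    · simp

variable {L}

theorem chainVec_of_eq {d : ℕ} (c : Chain K d) {i : ℕ} {σ : Simplex K (d + 1)}
    (h : L.getD i ∅ = σ.1) : chainVec L d c i = c σ := by
  have h' : L.getD i ∅ ∈ K ∧ (L.getD i ∅).card = d + 1 := by
    rw [h]
    exact σ.2
  refine (dif_pos h').trans ?_
  congr 1
  exact Subtype.ext h

theorem chainVec_of_not {d : ℕ} (c : Chain K d) {i : ℕ}
    (h : ¬ (L.getD i ∅ ∈ K ∧ (L.getD i ∅).card = d + 1)) : chainVec L d c i = 0 :=
  dif_neg h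

theorem chainVec_eq_coeff {d : ℕ} (c : Chain K d) (i : ℕ) :
    chainVec L d c i = ind (coeff c (L.getD i ∅) ≠ 0) := by
  by_cases h : L.getD i ∅ ∈ K ∧ (L.getD i ∅).card = d + 1
  · rw [chainVec_of_eq c (σ := ⟨_, h⟩) rfl, coeff, dif_pos h]
    generalize c ⟨L.getD i ∅, h⟩ = x
    rw [ne_eq, ZMod.val_eq_zero]
    by_cases hx : x = 0
    · rw [ind_false (by simpa using hx), hx]
    · rw [ind_true hx]
      revert x
      decide
  · rw [chainVec_of_not c h, coeff, dif_neg h, ind_false (by simp)]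

theorem coeff_eq_ite {d : ℕ} (c : Chain K d) (i : ℕ) :
    coeff c (L.getD i ∅) = if chainVec L d c i ≠ 0 then 1 else 0 := by
  by_cases h : L.getD i ∅ ∈ K ∧ (L.getD i ∅).card = d + 1
  · rw [chainVec_of_eq c (σ := ⟨_, h⟩) rfl, coeff, dif_pos h]
    generalize c ⟨L.getD i ∅, h⟩ = x
    revert x
    decide
  · rw [chainVec_of_not c h, coeff, dif_neg h]
    simp

open Classical in
theorem boundaryCol_eq (hL : Enumerates L K) {d j : ℕ} {σ : Simplex K (d + 2)}
    (h : L.getD j ∅ = σ.1) :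
    boundaryCol (face L) d j = chainVec L d (boundary K (d + 1) (Pi.single σ 1)) := by
  have hb : ∀ τ : Simplex K (d + 1), boundary K (d + 1) (Pi.single σ 1) τ = ind (τ.1 ⊆ σ.1) := by
    intro τ
    change ∑ σ' : Simplex K (d + 2), (if τ.1 ⊆ σ'.1 then (Pi.single σ 1 : _ → ZMod 2) σ' else 0) = _
    rw [Finset.sum_eq_single σ]
    · simp [ind]
    · intro σ' _ hne
      simp [hne]
    · simp
  have hsub : ∀ i, face L i ⊆ face L j ↔ L.getD i ∅ ⊆ L.getD j ∅ := fun i =>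
    Finset.map_subset_map
  funext i
  rw [boundaryCol, card_face, card_face, hsub]
  by_cases hi : (L.getD i ∅).card = d + 1
  · have hiK := hL.getD_mem_of_card hi
    rw [chainVec_of_eq _ (σ := ⟨_, hiK, hi⟩) rfl, hb]
    congr 1
    rw [h]
    simp only [hi, σ.2.2, true_and]
  · rw [chainVec_of_not _ (fun h => hi h.2), ind_false (fun h => hi h.1)]

/-- A column belonging to a `(d + 1)`-simplex is the boundary of that simplex, all other columns are
`0`, and each such simplex has an index below `w`. -/
theorem colSpan_boundaryCol (hL : Enumerates L K) (d : ℕ) {w : ℕ} (hw : L.length ≤ w) :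
    colSpan w (boundaryCol (face L) d) = (boundaries K d).map (chainVec L d) := by
  classical
  apply le_antisymm
  · refine Submodule.span_le.mpr ?_
    rintro _ ⟨j, _, rfl⟩
    by_cases hj : (L.getD j ∅).card = d + 2
    · have hjK := hL.getD_mem_of_card (k := d + 1) hj
      rw [boundaryCol_eq hL (σ := ⟨_, hjK, hj⟩) rfl]
      exact Submodule.mem_map_of_mem ⟨_, rfl⟩
    · have : boundaryCol (face L) d j = 0 := by
        funext i
        exact ind_false fun h => hj ((card_face L j).symm.trans h.2.1)
      rw [this]
      exact zero_mem _
  · rintro _ ⟨_, ⟨c, rfl⟩, rfl⟩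
    have hc : c = ∑ σ, c σ • (Pi.single σ 1 : Chain K (d + 1)) := by
      funext σ
      simp [Finset.sum_apply, Pi.single_apply]
    rw [hc, map_sum, map_sum]
    refine sum_mem fun σ _ => ?_
    rw [map_smul, map_smul]
    refine Submodule.smul_mem _ _ ?_
    obtain ⟨j, hj, hjσ⟩ := hL.exists_getD_eq σ.2.1
    rw [← boundaryCol_eq hL hjσ]
    exact col_mem_colSpan (hj.trans_le hw)

/-! ### Distances -/

theorem dist_le_succ_iff (p q : Fin m) (r : ℕ) : dist K p q ≤ (r + 1 : ℕ) ↔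
    dist K p q ≤ r ∨ ∃ u, dist K p u ≤ r ∧ (oneSkeleton K).Adj u q := by
  constructor
  · intro h
    -- A walk from `q` to `p` exposes the edge at `q` as its first one.
    rw [dist, SimpleGraph.edist_comm] at h
    obtain ⟨W, hW⟩ := SimpleGraph.exists_walk_of_edist_ne_top
      (ne_top_of_le_ne_top (ENat.natCast_ne_top (r + 1)) h)
    rw [← hW] at h
    cases W with
    | nil => exact Or.inl (by simp [dist])
    | cons hadj W =>
      refine Or.inr ⟨_, ?_, hadj.symm⟩
      rw [dist, SimpleGraph.edist_comm]
      refine (SimpleGraph.edist_le W).trans ?_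
      rw [SimpleGraph.Walk.length_cons] at h
      have h' : W.length + 1 ≤ r + 1 := by exact_mod_cast h
      exact_mod_cast Nat.le_of_succ_le_succ h'
  · rintro (h | ⟨u, h, hadj⟩)
    · exact h.trans (by exact_mod_cast Nat.le_succ r)
    · refine (SimpleGraph.edist_triangle (v := u)).trans ?_
      rw [SimpleGraph.edist_eq_one_iff_adj.mpr hadj]
      push_cast
      exact add_le_add_left h 1

/-- Removing the cycles of a walk leaves a path, which has fewer than `m` edges. This limits the
radii to be tried. -/
theorem dist_le_of_ne_top {p q : Fin m} (h : dist K p q ≠ ⊤) : dist K p q ≤ (m - 1 : ℕ) := by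
  classical
  obtain ⟨W, hW⟩ := SimpleGraph.exists_walk_of_edist_ne_top h
  refine (SimpleGraph.edist_le W.bypass).trans ?_
  have := (W.bypass_isPath).length_lt
  rw [Fintype.card_fin] at this
  exact_mod_cast (by omega : W.bypass.length ≤ m - 1)

theorem reach_iff (hL : Enumerates L K) {w : ℕ} (hw : L.length ≤ w) (p : Fin m) (r q : ℕ) :
    Reach w (face L) r p q ↔ ∃ h : q < m, dist K p ⟨q, h⟩ ≤ r := by
  induction r generalizing q with
  | zero =>
    rw [Reach]
    constructor
    · rintro rfl
      exact ⟨p.2, by simp [dist]⟩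
    · rintro ⟨h, hd⟩
      have : (p : Fin m) = ⟨q, h⟩ := by
        rw [← SimpleGraph.edist_eq_zero_iff (G := oneSkeleton K)]
        simpa [dist] using hd
      rw [this]
  | succ r ih =>
    rw [Reach, ih]
    simp only [ih]
    constructor
    · rintro (⟨h, hd⟩ | ⟨u, _, ⟨hu, hd⟩, i, _, hcard, hui, hqi⟩)
      · exact ⟨h, (dist_le_succ_iff _ _ _).mpr (Or.inl hd)⟩
      · obtain ⟨hq, hqi⟩ := mem_face.mp hqi
        obtain ⟨_, hui⟩ := mem_face.mp hui
        refine ⟨hq, (dist_le_succ_iff _ _ _).mpr ?_⟩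
        -- `Reach` also allows a stationary move within an edge, which does not change the distance.
        by_cases huq : u = q
        · subst huq
          exact Or.inl hd
        · refine Or.inr ⟨⟨u, hu⟩, hd, by simpa using huq, ?_⟩
          rw [card_face] at hcard
          have : ({⟨u, hu⟩, ⟨q, hq⟩} : Finset (Fin m)) = L.getD i ∅ := by
            refine Finset.eq_of_subset_of_card_le ?_ ?_
            · intro x hx
              rcases Finset.mem_insert.mp hx with rfl | hx
              · exact hui
              · rw [Finset.mem_singleton.mp hx]
                exact hqi
            · rw [hcard, Finset.card_pair (by simpa using huq)]
          rw [this]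
          exact hL.getD_mem_of_card hcard
    · rintro ⟨h, hd⟩
      rcases (dist_le_succ_iff _ _ _).mp hd with hd | ⟨u, hd, hne, hadj⟩
      · exact Or.inl ⟨h, hd⟩
      · obtain ⟨i, hi, hiu⟩ := hL.exists_getD_eq hadj
        refine Or.inr ⟨u, by have := hL.card_le; omega, ⟨u.2, hd⟩, i, by omega, ?_, ?_, ?_⟩
        · rw [card_face, hiu, Finset.card_pair hne]
        · exact mem_face.mpr ⟨u.2, by rw [hiu]; simp⟩
        · exact mem_face.mpr ⟨h, by rw [hiu]; simp⟩

theorem inside_chainVec_iff (hL : Enumerates L K) {w : ℕ} (hw : L.length ≤ w) {d : ℕ}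
    (c : Chain K d) (r : ℕ) (p : Fin m) :
    Inside w (face L) r p (chainVec L d c) ↔ ∀ q ∈ vert c, dist K p q ≤ r := by
  constructor
  · rintro h q ⟨σ, hσ, hq⟩
    obtain ⟨i, hi, hiσ⟩ := hL.exists_getD_eq σ.2.1
    by_contra hd
    refine hσ ?_
    rw [← chainVec_of_eq c hiσ]
    refine h i ⟨q, by have := hL.card_le; omega, mem_face.mpr ⟨q.2, by rwa [hiσ]⟩, ?_⟩
    rw [reach_iff hL hw]
    rintro ⟨_, h⟩
    exact hd h
  · rintro h i ⟨q, _, hq, hr⟩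
    by_contra hi
    obtain ⟨hqm, hq⟩ := mem_face.mp hq
    have hiK : L.getD i ∅ ∈ K ∧ (L.getD i ∅).card = d + 1 := by
      by_contra hn
      exact hi (chainVec_of_not c hn)
    rw [chainVec_of_eq c (σ := ⟨_, hiK⟩) rfl] at hi
    exact hr ((reach_iff hL hw p r q).mpr ⟨hqm, h _ ⟨_, hi, hq⟩⟩)

theorem radius_le_of_forall {d : ℕ} {c : Chain K d} {r : ℕ∞} {p : Fin m}
    (h : ∀ q ∈ vert c, dist K p q ≤ r) : radius c ≤ r :=
  iInf_le_of_le p (iSup₂_le h)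

theorem exists_forall_dist_le {d : ℕ} {c : Chain K d} (h : radius c ≠ ⊤) :
    ∃ p : Fin m, ∃ r < m, (r : ℕ∞) ≤ radius c ∧ ∀ q ∈ vert c, dist K p q ≤ r := by
  rcases isEmpty_or_nonempty (Fin m) with he | hne
  · exact absurd (by simp [radius]) h
  obtain ⟨p, hp⟩ := exists_eq_ciInf_of_finite (f := fun p : Fin m => ⨆ q ∈ vert c, dist K p q)
  obtain ⟨R, hR⟩ := ENat.ne_top_iff_exists.mp h
  have hp' : ⨆ q ∈ vert c, dist K p q = radius c := hp
  -- The cap `m - 1` puts the radius into the range searched, and finite distances respect it.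
  refine ⟨p, min R (m - 1), by have := p.2; omega, ?_, ?_⟩
  · rw [← hR]
    exact_mod_cast min_le_left _ _
  · intro q hq
    have h1 : dist K p q ≤ R := by
      rw [hR, ← hp']
      exact le_iSup₂ (f := fun q (_ : q ∈ vert c) => dist K p q) q hq
    have h2 := dist_le_of_ne_top (ne_top_of_le_ne_top (ENat.natCast_ne_top R) h1)
    exact le_min h1 (by exact_mod_cast h2)

/-- A vector homologous to `z₀` that fits into all balls that are feasible is a cycle of minimal
radius. -/
theorem exists_isMinRadiusCycle (hL : Enumerates L K) {w d : ℕ} (hw : L.length ≤ w) {g : ℕ → ℕ}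
    (hg0 : g 0 = m) (hg1 : g 1 = d) (z₀ : cycles K d) {v : ℕ → ZMod 2}
    (hv : v - chainVec L d (z₀ : Chain K d) ∈ colSpan w (boundaryCol (face L) (g 1)))
    (hfit : ∀ r < w, (∃ p < g 0, Feasible w g (face L) (chainVec L d (z₀ : Chain K d)) r p) →
      Fits w g (face L) r v) :
    ∃ z : cycles K d, IsMinRadiusCycle (homologyClass K d z₀) z ∧ chainVec L d (z : Chain K d) = v := by
  have hspan := colSpan_boundaryCol hL d hw
  rw [hg1, hspan] at hv
  obtain ⟨b, hb, hbv⟩ := hv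
  refine ⟨⟨z₀ + b, add_mem z₀.2 (boundaries_le_cycles K d hb)⟩, ?_, ?_⟩
  swap
  · rw [map_add, hbv]
    abel
  refine ⟨?_, ?_⟩
  · rw [homologyClass_eq_iff]
    simpa using hb
  · intro c hc
    by_cases htop : radius (c : Chain K d) = ⊤
    · rw [htop]
      exact le_top
    obtain ⟨p, r, hr, hrad, hdist⟩ := exists_forall_dist_le htop
    have hmw := hL.card_le.trans hw
    -- The competitor `c` itself witnesses feasibility of its own ball.
    obtain ⟨r', hr', p', hp', hin⟩ := hfit r (by omega) ⟨p, by rw [hg0]; exact p.2,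
      chainVec L d (c : Chain K d), by
        rw [hg1, hspan, ← map_sub]
        exact Submodule.mem_map_of_mem ((homologyClass_eq_iff _ _).mp hc),
      (inside_chainVec_iff hL hw _ _ _).mpr hdist⟩
    have hv : v = chainVec L d ((z₀ : Chain K d) + b) := by
      rw [map_add, hbv]
      abel
    rw [hg0] at hp'
    rw [hv, inside_chainVec_iff hL hw _ r' ⟨p', hp'⟩] at hin
    exact (radius_le_of_forall hin).trans ((by exact_mod_cast hr' : (r' : ℕ∞) ≤ r).trans hrad)

end

end MinRadius

/-! ### Layout of the input word, and assembly of the result. -/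

namespace MinRadius

open Term Stmt

/-! ### The input word -/

section

variable {m : ℕ} {K : AbstractSimplicialComplex (Fin m)} {L : List (Finset (Fin m))} {d : ℕ}

/-- The length of the words of the first `i` simplices. -/
def offset (L : List (Finset (Fin m))) (i : ℕ) : ℕ := ((L.take i).flatMap simplexWord).length

/-- The entries of the input word. -/
noncomputable def inputEntry (L : List (Finset (Fin m))) (c : Chain K d) (t : ℕ) : ℕ :=
  (inputWord L c).getD t 0

theorem length_simplexWord (σ : Finset (Fin m)) : (simplexWord σ).length = σ.card + 1 := by
  simp [simplexWord]

theorem flatMap_eq_append (L : List (Finset (Fin m))) {i : ℕ} (hi : i < L.length) :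
    L.flatMap simplexWord = (L.take i).flatMap simplexWord ++ (simplexWord (L.getD i ∅) ++
      (L.drop (i + 1)).flatMap simplexWord) := by
  conv_lhs => rw [← List.take_append_drop i L, List.drop_eq_getElem_cons hi]
  rw [List.flatMap_append, List.flatMap_cons, List.getD_eq_getElem _ _ hi]

theorem offset_succ (L : List (Finset (Fin m))) {i : ℕ} (hi : i < L.length) :
    offset L (i + 1) = offset L i + ((L.getD i ∅).card + 1) := by
  rw [offset, offset, List.take_succ_eq_append_getElem hi, List.flatMap_append, List.length_append,
    List.getD_eq_getElem _ _ hi, ← length_simplexWord]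
  simp

theorem offset_le (L : List (Finset (Fin m))) (i : ℕ) (hi : i ≤ L.length) :
    offset L i ≤ i * (m + 1) := by
  induction i with
  | zero => simp [offset]
  | succ i ih =>
    rw [offset_succ L hi, Nat.succ_mul]
    have h1 := Finset.card_le_univ (L.getD i ∅)
    rw [Fintype.card_fin] at h1
    have h2 := ih (by omega)
    omega

theorem length_inputWord (L : List (Finset (Fin m))) (c : Chain K d) :
    (inputWord L c).length = 3 + offset L L.length + L.length := by
  simp only [inputWord, List.length_cons, List.length_append, offset, List.take_length, chainWord,
    List.length_map]
  omega

theorem inputEntry_add_three (c : Chain K d) (t : ℕ) :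
    inputEntry L c (3 + t) = (L.flatMap simplexWord ++ chainWord L c).getD t 0 := by
  rw [inputEntry, inputWord, add_comm 3 t]
  rfl

theorem inputEntry_simplex (c : Chain K d) {i s : ℕ} (hi : i < L.length)
    (hs : s < (simplexWord (L.getD i ∅)).length) :
    inputEntry L c (3 + offset L i + s) = (simplexWord (L.getD i ∅)).getD s 0 := by
  rw [add_assoc, inputEntry_add_three, flatMap_eq_append L hi, List.append_assoc,
    List.getD_append_right _ _ _ _ (by rw [offset]; omega), offset, Nat.add_sub_cancel_left,
    List.append_assoc, List.getD_append _ _ _ _ hs]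

theorem inputEntry_coeff (c : Chain K d) {i : ℕ} (hi : i < L.length) :
    inputEntry L c (3 + offset L L.length + i) = coeff c (L.getD i ∅) := by
  rw [add_assoc, inputEntry_add_three, offset, List.take_length,
    List.getD_append_right _ _ _ _ (by omega), Nat.add_sub_cancel_left, chainWord,
    List.getD_eq_getElem _ _ (by simpa using hi), List.getElem_map, List.getD_eq_getElem _ _ hi]

theorem position_inputEntry (c : Chain K d) {i : ℕ} (hi : i ≤ L.length) :
    position (inputEntry L c) i = 3 + offset L i := by
  induction i with
  | zero => simp [position, offset]
  | succ i ih =>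
    have h : inputEntry L c (3 + offset L i) = (L.getD i ∅).card := by
      have := inputEntry_simplex (s := 0) c hi (by simp [length_simplexWord])
      simpa [simplexWord] using this
    rw [position, ih (by omega), h, offset_succ L hi]
    omega

theorem offset_mono (L : List (Finset (Fin m))) {i : ℕ} (hi : i < L.length) :
    offset L i + ((L.getD i ∅).card + 1) ≤ offset L L.length := by
  rw [offset, offset, List.take_length, flatMap_eq_append L hi, List.length_append,
    List.length_append, length_simplexWord]
  omega

/-- The `card` entries after the count in the `i`-th block are the vertices. The bound by the word
length holds automatically, since the block lies within the word. -/
theorem incidence_iff (c : Chain K d) (i q : ℕ) :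
    (i < L.length ∧ ∃ t < (inputWord L c).length, position (inputEntry L c) i < t ∧
      t ≤ position (inputEntry L c) i + inputEntry L c (position (inputEntry L c) i) ∧
      inputEntry L c t = q) ↔ q ∈ face L i := by
  by_cases hi : i < L.length
  swap
  · refine iff_of_false (fun h => hi h.1) fun h => ?_
    rw [face, List.getD_eq_default _ _ (by omega)] at h
    simp at h
  have hcard : inputEntry L c (3 + offset L i) = (L.getD i ∅).card := by
    have := inputEntry_simplex (s := 0) c hi (by simp [length_simplexWord])
    simpa [simplexWord] using this
  have hoff := offset_mono L hi
  have hentry : ∀ s < (L.getD i ∅).card, inputEntry L c (3 + offset L i + (s + 1)) =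
      (((L.getD i ∅).sort (· ≤ ·)).map Fin.val).getD s 0 := by
    intro s hs
    rw [inputEntry_simplex c hi (by rw [length_simplexWord]; omega), simplexWord,
      List.getD_cons_succ]
  rw [position_inputEntry c hi.le, hcard, length_inputWord]
  have hface : q ∈ face L i ↔ q ∈ ((L.getD i ∅).sort (· ≤ ·)).map Fin.val := by
    rw [face, Finset.mem_map, List.mem_map]
    simp only [Finset.mem_sort]
    rfl
  rw [hface, List.mem_iff_getElem]
  have hlen : (((L.getD i ∅).sort (· ≤ ·)).map Fin.val).length = (L.getD i ∅).card := by simp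
  constructor
  · rintro ⟨_, t, _, h1, h2, rfl⟩
    obtain ⟨s, rfl⟩ : ∃ s, t = 3 + offset L i + (s + 1) := ⟨t - (3 + offset L i) - 1, by omega⟩
    refine ⟨s, by omega, ?_⟩
    rw [hentry s (by omega)]
    exact (List.getD_eq_getElem _ _ _).symm
  · rintro ⟨s, hs, rfl⟩
    refine ⟨hi, 3 + offset L i + (s + 1), by omega, by omega, by omega, ?_⟩
    rw [hentry s (by omega), List.getD_eq_getElem _ _ hs]

theorem hasInput_inputEntry (c : Chain K d) :
    HasInput (inputWord L c).length (inputEntry L c) (initStore (inputWord L c)) := by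
  refine ⟨fun i j => ?_, fun j hj => List.getD_eq_default _ _ hj⟩
  simp [initStore, inputEntry]

/-- The algorithm writes the coefficients of a cycle of minimal radius into the output array. -/
theorem minRadiusStmt_spec (hL : Enumerates L K) (z₀ : cycles K d) :
    ∃ z : cycles K d, IsMinRadiusCycle (homologyClass K d z₀) z ∧
      HasInput (inputWord L (z₀ : Chain K d)).length (inputEntry L (z₀ : Chain K d))
        (minRadiusStmt.exec (inputWord L (z₀ : Chain K d)).length []
          (initStore (inputWord L (z₀ : Chain K d)))) ∧
      ∀ j, minRadiusStmt.exec (inputWord L (z₀ : Chain K d)).length []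
        (initStore (inputWord L (z₀ : Chain K d))) 1 0 j = coeff (z : Chain K d) (L.getD j ∅) := by
  set w := (inputWord L (z₀ : Chain K d)).length with hw
  set g := inputEntry L (z₀ : Chain K d) with hg
  set μ := initStore (inputWord L (z₀ : Chain K d)) with hμ
  have hwlen : w = 3 + offset L L.length + L.length := length_inputWord L _
  have hw0 : 0 < w := by omega
  have hg0 : g 0 = m := rfl
  have hg1 : g 1 = d := rfl
  have hg2 : g 2 = L.length := rfl
  have hin : HasInput w g μ := hasInput_inputEntry _
  have hmL := hL.card_le
  set μ₁ := findPositions.exec w [] μ with hμ₁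
  have h01 : μ₁ 0 = μ 0 := exec_of_not_mem_writes _ (by decide) _ _
  have hin₁ : HasInput w g μ₁ := by
    rw [HasInput, h01]
    exact hin
  set μ₂ := findIncidences.exec w [] μ₁ with hμ₂
  have h02 : μ₂ 0 = μ 0 := (exec_of_not_mem_writes _ (by decide) _ _).trans h01
  have hfaces₂ : HasFaces w g (face L) μ₂ := by
    refine ⟨hw0, ?_, ?_, ?_, ?_⟩
    · rw [HasInput, h02]
      exact hin
    · intro i q hq
      obtain ⟨hq, _⟩ := mem_face.mp hq
      omega
    · intro i hi
      rw [face, List.getD_eq_default _ _ (by omega), Finset.map_empty]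
    · intro i q
      rw [hμ₂, findIncidences_spec hw0 hin₁ (by omega) (findPositions_spec hw0 hin)]
      exact if_congr (incidence_iff _ i q) rfl rfl
  set μ₃ := readCycle.exec w [] μ₂ with hμ₃
  have hfaces₃ : HasFaces w g (face L) μ₃ := hfaces₂.exec (by decide) (by decide) _
  have hdiag : diag μ₃ 4 = chainVec L d (z₀ : Chain K d) := by
    funext i
    rw [diag, hμ₃, readCycle_spec hw0 hfaces₂.input, hg2, chainVec_eq_coeff]
    by_cases hi : i < L.length
    · rw [if_pos hi, show w + i - L.length = 3 + offset L L.length + i by omega, hg,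
        inputEntry_coeff _ hi]
    · rw [if_neg hi, ← chainVec_eq_coeff, chainVec_of_not, ind_false (by simp)]
      rintro ⟨hK, _⟩
      rw [List.getD_eq_default _ _ (by omega)] at hK
      exact Finset.not_nonempty_empty (nonempty_of_mem hK)
  obtain ⟨hv, hfit⟩ := iter_tryRadius_spec hfaces₃ (by omega : g 0 ≤ w)
  set μ₄ := (Stmt.iter tryRadius).exec w [] μ₃ with hμ₄
  rw [hdiag] at hv hfit
  obtain ⟨z, hz, hzv⟩ := exists_isMinRadiusCycle hL (by omega : L.length ≤ w) hg0 hg1 z₀ hv hfit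
  have hexec : minRadiusStmt.exec w [] μ =
      (Stmt.assign 1 (bool (.get 4 0 0))).exec w [] μ₄ := rfl
  refine ⟨z, hz, ?_, fun j => ?_⟩
  · rw [hexec]
    exact ((hfaces₃.exec (by decide) (by decide) _).exec (by decide) (by decide) _).input
  · classical
    rw [hexec, exec_assign_self, eval_bool, coeff_eq_ite, hzv]
    exact if_congr ind_ne_zero.symm rfl rfl

end

open Polynomial in
-- Natural coefficients make the polynomial monotone, so the word length may be replaced by its
-- bound in `n`.
theorem eval_mono (p : ℕ[X]) {a b : ℕ} (h : a ≤ b) : p.eval a ≤ p.eval b := by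
  rw [eval_eq_sum, eval_eq_sum]
  exact Finset.sum_le_sum fun i _ => Nat.mul_le_mul_left _ (Nat.pow_le_pow_left h i)

end MinRadius

/-- One program computes, for every finite simplicial complex `K` (listed in any order), every
dimension `d` and every class `h` in `H_d(K)` given by a representative cycle `z₀`, a representative
cycle of `h` of minimal radius, in time polynomial in the number of simplices of `K`. -/
theorem theorem5p3 :
    ∃ (P : MinRadius.Program) (p : Polynomial ℕ),
      ∀ (m : ℕ) (K : AbstractSimplicialComplex (Fin m)) (L : List (Finset (Fin m))),
        MinRadius.Enumerates L K →
        ∀ (d : ℕ) (h : MinRadius.Homology K d) (z₀ : MinRadius.cycles K d),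
          MinRadius.homologyClass K d z₀ = h →
          ∃ z : MinRadius.cycles K d,
            MinRadius.IsMinRadiusCycle h z ∧
            P.OutputsWithin
              (MinRadius.inputWord L (z₀ : MinRadius.Chain K d))
              (MinRadius.chainWord L (z : MinRadius.Chain K d))
              (p.eval L.length) := by
  -- The output length is the number of simplices, entry `2` of the input, which is still intact at
  -- the end.
  refine ⟨MinRadius.wordProgram MinRadius.minRadiusStmt (MinRadius.Term.inp (.const 2)),
    (MinRadius.wordTime MinRadius.minRadiusStmt (MinRadius.Term.inp (.const 2))).comp
      -- Three header entries, at most `n` blocks of length at most `m + 1 ≤ n + 1`, and `n`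
      -- coefficients.
      (3 + Polynomial.X * (Polynomial.X + 1) + Polynomial.X), ?_⟩
  rintro m K L hL d _ z₀ rfl
  obtain ⟨z, hz, hin, hout⟩ := MinRadius.minRadiusStmt_spec hL z₀
  refine ⟨z, hz, ?_⟩
  set input := MinRadius.inputWord L (z₀ : MinRadius.Chain K d) with hinput
  have hlen : input.length = 3 + MinRadius.offset L L.length + L.length :=
    MinRadius.length_inputWord L _
  have hw : 0 < input.length := by omega
  have hn : (MinRadius.Term.inp (.const 2)).eval input.length
      (MinRadius.minRadiusStmt.exec input.length [] (MinRadius.initStore input)) [] = L.length :=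
    MinRadius.Term.eval_inp_const hin hw 2
  obtain ⟨t, ht, s, hrun, hs⟩ := MinRadius.wordProgram_outputsWithin MinRadius.minRadiusStmt
    (.inp (.const 2)) input hw (by rw [hn]; omega)
  refine ⟨t, ht.trans ?_, s, hrun, ?_⟩
  · rw [Polynomial.eval_comp]
    refine MinRadius.eval_mono _ ?_
    have h1 := MinRadius.offset_le L L.length le_rfl
    have h2 : L.length * (m + 1) ≤ L.length * (L.length + 1) :=
      Nat.mul_le_mul_left _ (Nat.succ_le_succ hL.card_le)
    simp only [Polynomial.eval_add, Polynomial.eval_mul, Polynomial.eval_X, Polynomial.eval_one,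
      Polynomial.eval_ofNat]
    omega
  · rw [hs, hn, MinRadius.chainWord]
    refine List.ext_getElem (by simp) fun j h1 h2 => ?_
    have hj : j < L.length := by simpa using h2
    simp only [List.getElem_map, List.getElem_range]
    rw [hout, List.getD_eq_getElem _ _ hj]
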